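/- Let $\{\mathbf X_{n,k}=(X_{n,k}^{(1)},X_{n,k}^{(2)}),\ 1\le k\le n,\ n\ge 1\}$ be a triangular array of bivariate random vectors such that, for each $n$, the $2n$ entries of row $n$ are jointly Gaussian with mean zero and unit variance, and $$\operatorname{corr}\bigl(X_{n,k}^{(1)},X_{n,k}^{(2)}\bigr)=\rho_0(n),\qquad \operatorname{corr}\bigl(X_{n,k}^{(i)},X_{n,l}^{(j)}\bigr)=\rho_{ij}(|k-l|,n)\quad (1\le k\ne l\le n,\ i,j\in\{1,2\}).$$ Suppose that $$\sigma:=\sup_{n\ge 2,\ 1\le k<n,\ i,j\in\{1,2\}}|\rho_{ij}(k,n)|<1,$$ and that for some $\alpha\in\bigl(0,\tfrac{1-\sigma}{1+\sigma}\bigr)$, with $I_n:=\lfloor n^{\alpha}\rfloor$, $$\lim_{n\to\infty}\ \max_{I_n\le k<n,\ i,j\in\{1,2\}}|\rho_{ij}(k,n)|\,\ln n=0.$$ Suppose further that $\lim_{n\to\infty}(1-\rho_0(n))\ln n=\lambda^2$ for some $\lambda\in[0,\infty]$. Let $M_n^{(i)}:=\max_{1\le k\le n}X_{n,k}^{(i)}$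 for $i=1,2$, and $u_n(s):=a_ns+b_n$ with $$a_n=\frac1{\sqrt{2\ln n}},\qquad b_n=\sqrt{2\ln n}-\frac{1}{2\sqrt{2\ln n}}\ln(4\pi\ln n).$$ Then $$\lim_{n\to\infty}\ \sup_{x,y\in\mathbb R}\Bigl|\mathbb P\bigl(M_n^{(1)}\le u_n(x),\,M_n^{(2)}\le u_n(y)\bigr)-H_\lambda(x,y)\Bigr|=0,$$ where $H_\lambda$ is the Hüsler–Reiss distribution function: with $\Phi$ the standard normal distribution function and $\Lambda(x)=\exp(-e^{-x})$, $$H_\lambda(x,y)=\exp\Bigl(-\Phi\bigl(\lambda+\tfrac{x-y}{2\lambda}\bigr)e^{-y}-\Phi\bigl(\lambda+\tfrac{y-x}{2\lambda}\bigr)e^{-x}\Bigr)\quad\text{for }0<\lambda<\infty,$$ $H_0(x,y)=\min(\Lambda(x),\Lambda(y))$ and $H_\infty(x,y)=\Lambda(x)\Lambda(y)$. -/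

import Mathlib

open MeasureTheory ProbabilityTheory Filter Topology
open scoped ENNReal

noncomputable section

namespace HuslerReiss

/-- Pearson correlation of two real random variables. -/
def corr {Ω : Type*} [MeasurableSpace Ω] (P : Measure Ω) (U V : Ω → ℝ) : ℝ :=
  covariance U V P / (Real.sqrt (variance U P) * Real.sqrt (variance V P))

/-- A bivariate stationary Gaussian triangular array: `X n k i` is the `i`-th component of the
`k`-th vector of row `n`. Each row is jointly Gaussian with centred entries of variance one;
nothing is assumed about the joint law of different rows. Within row `n`, the two components of a
vector have correlation `ρ₀ n`, and the correlation of entries of two different vectors depends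
on the vectors only through their distance. Only the values `ρ i j k n` with `1 ≤ k < n` occur. -/
structure IsStationaryGaussianArray {Ω : Type*} [MeasurableSpace Ω] (P : Measure Ω)
    (X : (n : ℕ) → Fin n → Fin 2 → Ω → ℝ) (ρ₀ : ℕ → ℝ)
    (ρ : Fin 2 → Fin 2 → ℕ → ℕ → ℝ) : Prop where
  gaussian : ∀ n, HasGaussianLaw (fun ω (p : Fin n × Fin 2) => X n p.1 p.2 ω) P
  mean_zero : ∀ n k i, ∫ ω, X n k i ω ∂P = 0
  variance_one : ∀ n k i, variance (X n k i) P = 1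
  corr_same : ∀ n k, corr P (X n k 0) (X n k 1) = ρ₀ n
  corr_ne : ∀ n (k l : Fin n), k ≠ l → ∀ i j,
    corr P (X n k i) (X n l j) = ρ i j ((k : ℤ) - (l : ℤ)).natAbs n

/-- `σ`, the supremum of `|ρ i j k n|` over `i, j`, `n ≥ 2` and `1 ≤ k < n`. -/
def maxCorr (ρ : Fin 2 → Fin 2 → ℕ → ℕ → ℝ) : ℝ :=
  sSup {r | ∃ i j k n, 1 ≤ k ∧ k < n ∧ r = |ρ i j k n|}

/-- The maximum of `|ρ i j k n|` over `i, j` and `m ≤ k < n` (a finite set). -/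
def tailMaxCorr (ρ : Fin 2 → Fin 2 → ℕ → ℕ → ℝ) (m n : ℕ) : ℝ :=
  sSup {r | ∃ i j k, m ≤ k ∧ k < n ∧ r = |ρ i j k n|}

/-- The Berman-type weak dependence condition with exponent `α`. -/
structure BermanCondition (ρ : Fin 2 → Fin 2 → ℕ → ℕ → ℝ) (α : ℝ) : Prop where
  maxCorr_lt_one : maxCorr ρ < 1
  alpha_pos : 0 < α
  alpha_lt : α < (1 - maxCorr ρ) / (1 + maxCorr ρ)
  tendsto_zero :
    Tendsto (fun n : ℕ => tailMaxCorr ρ ⌊(n : ℝ) ^ α⌋₊ n * Real.log n) atTop (𝓝 0)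

/-- The Hüsler–Reiss condition `(1 - ρ₀ n) ln n → lam ^ 2 ∈ [0, ∞]`. -/
def HuslerReissCondition (ρ₀ : ℕ → ℝ) (lam : ℝ≥0∞) : Prop :=
  Tendsto (fun n : ℕ => (((1 - ρ₀ n) * Real.log n : ℝ) : EReal)) atTop
    (𝓝 ((lam ^ 2 : ℝ≥0∞) : EReal))

/-- The standard normal distribution function. -/
def Phi (x : ℝ) : ℝ := cdf (gaussianReal 0 1) x

/-- The Gumbel distribution function. -/
def gumbel (x : ℝ) : ℝ := Real.exp (-Real.exp (-x))

/-- The Hüsler–Reiss distribution function with parameter `lam ∈ [0, ∞]`. -/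
def H (lam : ℝ≥0∞) (x y : ℝ) : ℝ :=
  if lam = 0 then min (gumbel x) (gumbel y)
  else if lam = ∞ then gumbel x * gumbel y
  else Real.exp
    (-(Phi (lam.toReal + (x - y) / (2 * lam.toReal)) * Real.exp (-y))
      - Phi (lam.toReal + (y - x) / (2 * lam.toReal)) * Real.exp (-x))

/-- The `i`-th componentwise maximum of row `n` (meaningful for `n ≥ 1`). -/
def rowMax {Ω : Type*} (X : (n : ℕ) → Fin n → Fin 2 → Ω → ℝ) (n : ℕ) (i : Fin 2) (ω : Ω) : ℝ :=
  ⨆ k : Fin n, X n k i ω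

/-- The scale `a_n` (meaningful for `n ≥ 2`). -/
def a (n : ℕ) : ℝ := 1 / Real.sqrt (2 * Real.log n)

/-- The location `b_n` (meaningful for `n ≥ 2`). -/
def b (n : ℕ) : ℝ :=
  Real.sqrt (2 * Real.log n)
    - 1 / (2 * Real.sqrt (2 * Real.log n)) * Real.log (4 * Real.pi * Real.log n)

/-- The threshold `u_n(s) = a_n s + b_n`. -/
def u (n : ℕ) (s : ℝ) : ℝ := a n * s + b n

end HuslerReiss

end

open scoped NNReal

noncomputable section

namespace HuslerReiss

/-! ### Gaussian integration by parts -/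

/-! The row is compared with a row whose `n` vectors have the same bivariate laws but are
independent. For independent vectors the limit is a computation; the comparison error vanishes under
the Berman condition.

Comparison (`abs_measureReal_sub_le`, `abs_prod_measureReal_sub_le`). Join the two Gaussian vectors
by the rotation `cos θ ξ + sin θ η` and differentiate the expectation of a product of smooth cutoffs
in `θ`. Gaussian integration by parts turns the derivative into a sum over pairs of covariance
differences times `E[φ'_i φ'_j]`. Each `|φ'_i|` is a subprobability density on `[v, ∞)`, so this
expectation is at most the maximum of a bivariate normal density on `[v, ∞)²`, of order `exp(-v² /
(1 + |r|))`. Pairs within one vector do not contribute.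

Error (`abs_measureReal_rowMax_sub_le`). Take `v = u n (min x y)`, so that `exp(-v²)` is of order
`n⁻² ln n`. There are `O(n · n^α)` pairs at lag below `n^α`, each contributing `n^(-2/(1+σ))` up to
a power of `ln n`; the total vanishes because `α < (1-σ)/(1+σ)`. There are `O(n²)` remaining pairs,
with correlation at most `δ n`; they contribute about `δ n ln n · exp(2 δ n ln n)`, which vanishes
because `δ n ln n → 0`.

Independent vectors (`tendsto_one_sub_tailProb_pow`). The probability is `(1 - tailProb)^n`, so the
limit of `n * tailProb` is needed. Put the second component at `u n t`: its density in `t`, times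
`n`, tends to `exp(-t)`, and the conditional probability that the first component stays below `u n
x` tends to `Φ(λ + (x-t)/(2λ))`, or to its degenerate form when `λ` is `0` or `∞`. Dominated
convergence gives an integral with an explicit antiderivative (`integral_exp_mul_Phi`).

Uniformity (`tendsto_iSup_abs_sub`) follows from pointwise convergence of monotone functions to a
continuous limit, with control of the tails. -/

lemma hasDerivAt_gaussianPDFReal_zero (v : ℝ≥0) (x : ℝ) :
    HasDerivAt (gaussianPDFReal 0 v) (-(x / v) * gaussianPDFReal 0 v x) x := by
  rcases eq_or_ne v 0 with rfl | hv
  · simp only [gaussianPDFReal_zero_var, Pi.zero_apply, mul_zero]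
    exact hasDerivAt_const x 0
  have hv' : (v : ℝ) ≠ 0 := by exact_mod_cast hv
  have h : HasDerivAt (fun x : ℝ => -(x - 0) ^ 2 / (2 * v)) (-(x / v)) x := by
    have := (((hasDerivAt_id x).sub_const 0).fun_pow 2).fun_neg.div_const (2 * (v : ℝ))
    convert! this using 1
    simp; field_simp
  have := h.exp.const_mul (√(2 * Real.pi * v))⁻¹
  rw [gaussianPDFReal_def]
  convert! this using 1
  simp; ring

lemma integrable_id_gaussianReal (v : ℝ≥0) : Integrable (fun x : ℝ => x) (gaussianReal 0 v) :=
  memLp_one_iff_integrable.1 (memLp_id_gaussianReal' 1 ENNReal.one_ne_top)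

/-- Stein's identity for a centred real Gaussian variable. -/
lemma integral_mul_gaussianReal {h h' : ℝ → ℝ} {C : ℝ} (v : ℝ≥0)
    (hd : ∀ x, HasDerivAt h (h' x) x) (hb : ∀ x, |h x| ≤ C) (hb' : ∀ x, |h' x| ≤ C) :
    ∫ x, x * h x ∂gaussianReal 0 v = v * ∫ x, h' x ∂gaussianReal 0 v := by
  rcases eq_or_ne v 0 with rfl | hv
  · simp
  have hv' : (v : ℝ) ≠ 0 := by exact_mod_cast hv
  rw [integral_gaussianReal_eq_integral_smul hv, integral_gaussianReal_eq_integral_smul hv]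
  have hh' : h' = deriv h := funext fun x => (hd x).deriv.symm
  have hm' : Measurable h' := hh' ▸ measurable_deriv h
  have hm : Measurable h := (continuous_iff_continuousAt.2 fun x => (hd x).continuousAt).measurable
  have hpi : Integrable (gaussianPDFReal 0 v) := integrable_gaussianPDFReal 0 v
  have hxp : Integrable fun x => gaussianPDFReal 0 v x * x := by
    have h1 := integrable_id_gaussianReal v
    rw [gaussianReal_of_var_ne_zero 0 hv] at h1
    rw [integrable_withDensity_iff_integrable_smul' (measurable_gaussianPDF 0 v)
      (ae_of_all _ fun x => gaussianPDF_lt_top)] at h1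
    simpa using h1
  have key := integral_mul_deriv_eq_deriv_mul_of_integrable (u := h) (u' := h')
    (v := gaussianPDFReal 0 v) (v' := fun x => -(x / v) * gaussianPDFReal 0 v x)
    (fun x _ => hd x) (fun x _ => hasDerivAt_gaussianPDFReal_zero v x) ?_ ?_ ?_
  · have e1 : ∫ x, gaussianPDFReal 0 v x • (x * h x) =
        -(v : ℝ) * ∫ x, h x * (-(x / v) * gaussianPDFReal 0 v x) := by
      rw [← integral_const_mul]
      congr with x
      simp; field_simp
    rw [e1, key, neg_mul_neg]
    congr 2 with x
    simp [mul_comm]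
  · have := (hxp.bdd_mul (c := C) hm.aestronglyMeasurable (ae_of_all _ hb)).const_mul (-(v : ℝ)⁻¹)
    refine this.congr (ae_of_all _ fun x => ?_)
    simp; field_simp
  · exact hpi.bdd_mul (c := C) hm'.aestronglyMeasurable (ae_of_all _ hb')
  · exact hpi.bdd_mul (c := C) hm.aestronglyMeasurable (ae_of_all _ hb)

variable {Ω : Type*} [MeasurableSpace Ω] {P : Measure Ω}

/-- Gaussian integration by parts: if `(Y, Z)` is jointly Gaussian with `Y` centred and `g'` is the
derivative of `g` in the direction `c = (cov[Y, Z j])_j`, then `E[Y g(Z)] = E[g'(Z)]`. -/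
lemma integral_mul_comp_eq_integral_deriv {ι : Type*} [Fintype ι] {Y : Ω → ℝ} {Z : Ω → ι → ℝ}
    (hYZ : HasGaussianLaw (fun ω => (Y ω, Z ω)) P) (hY : ∫ ω, Y ω ∂P = 0)
    {c : ι → ℝ} (hc : ∀ j, c j = cov[Y, fun ω => Z ω j; P])
    {g g' : (ι → ℝ) → ℝ} {C : ℝ} (hg : Measurable g) (hg' : Measurable g')
    (hd : ∀ z, HasDerivAt (fun t : ℝ => g (z + t • c)) (g' z) 0)
    (hb : ∀ z, |g z| ≤ C) (hb' : ∀ z, |g' z| ≤ C) :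
    ∫ ω, Y ω * g (Z ω) ∂P = ∫ ω, g' (Z ω) ∂P := by
  have := hYZ.isProbabilityMeasure
  have hYg : HasGaussianLaw Y P := hYZ.fst
  have hZg : HasGaussianLaw Z P := hYZ.snd
  have hZj (j : ι) : HasGaussianLaw (fun ω => Z ω j) P :=
    hZg.map_fun (ContinuousLinearMap.proj j)
  set v : ℝ := Var[Y; P] with hvdef
  have hvc : cov[Y, Y; P] = v := covariance_self hYg.aemeasurable
  -- If `Y` is degenerate, it vanishes almost surely, hence `c = 0` and the directional derivative
  -- `g'` is identically zero.
  rcases eq_or_ne v 0 with hv | hv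
  · have hY0 : Y =ᵐ[P] 0 := by
      have := (ae_eq_integral_of_variance_eq_zero hYg.memLp_two hv)
      filter_upwards [this] with ω h
      rw [h, hY]; rfl
    have hc0 : c = 0 := by
      ext j
      rw [hc, covariance]
      refine integral_eq_zero_of_ae ?_
      filter_upwards [hY0] with ω h
      simp [h, hY]
    have hg0 : g' = 0 := by
      ext z
      have := hd z
      simp only [hc0, smul_zero, add_zero] at this
      exact (this.unique (hasDerivAt_const _ _))
    rw [hg0, integral_eq_zero_of_ae]
    · simp
    · filter_upwards [hY0] with ω h
      simp [h]
  have hvpos : 0 < v := lt_of_le_of_ne (variance_nonneg _ _) hv.symm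
  -- The residual of the regression of `Z` on `Y` is uncorrelated with `Y`, hence independent of it
  -- by joint Gaussianity.
  set W : Ω → ι → ℝ := fun ω => Z ω - (Y ω / v) • c with hW
  have hind : IndepFun Y W P := by
    have h1 : HasGaussianLaw (fun ω => ((fun _ : Unit => Y ω), fun j => W ω j)) P := by
      have := hYZ.map_fun ((ContinuousLinearMap.pi fun _ : Unit => ContinuousLinearMap.fst ℝ ℝ (ι → ℝ)).prod
        (ContinuousLinearMap.snd ℝ ℝ (ι → ℝ) -
          (ContinuousLinearMap.fst ℝ ℝ (ι → ℝ)).smulRight (v⁻¹ • c)))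
      convert! this using 3
      ext j
      simp [hW]; ring
    have h2 := h1.indepFun_of_covariance_eval (X := fun _ : Unit => Y) (Y := fun j ω => W ω j) ?_
    · exact h2.comp (measurable_pi_apply ()) measurable_id
    · intro _ j
      have : (fun ω => W ω j) = fun ω => Z ω j - (c j / v) * Y ω := by
        ext ω; simp [hW]; ring
      rw [this, covariance_fun_sub_right hYg.memLp_two (hZj j).memLp_two
        (hYg.memLp_two.const_mul _), covariance_const_mul_right, hvc, ← hc]
      field_simp; ring
  have hYm : AEMeasurable Y P := hYg.aemeasurable
  have hWm : AEMeasurable W P := hZg.aemeasurable.sub ((hYm.div_const v).smul_const c)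
  have hmap := hind.map_prod_eq_prod_map_map hYm hWm
  have hYlaw : P.map Y = gaussianReal 0 v.toNNReal := by rw [hYg.map_eq_gaussianReal, hY]
  have hmeas : Measurable fun q : ℝ × (ι → ℝ) => q.2 + (q.1 / v) • c := by fun_prop
  have hZeq (ω : Ω) : Z ω = W ω + (Y ω / v) • c := by simp [hW]
  have hpm : AEMeasurable (fun ω => (Y ω, W ω)) P := hYm.prodMk hWm
  have : IsProbabilityMeasure (P.map W) := Measure.isProbabilityMeasure_map hWm
  have hYint := integrable_id_gaussianReal v.toNNReal
  have e1 : ∫ ω, Y ω * g (Z ω) ∂P =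
      ∫ q, q.1 * g (q.2 + (q.1 / v) • c) ∂((gaussianReal 0 v.toNNReal).prod (P.map W)) := by
    rw [← hYlaw, ← hmap, integral_map hpm]
    · simp only [hZeq]
    · exact (measurable_fst.mul (hg.comp hmeas)).aestronglyMeasurable
  have e2 : ∫ ω, g' (Z ω) ∂P =
      ∫ q, g' (q.2 + (q.1 / v) • c) ∂((gaussianReal 0 v.toNNReal).prod (P.map W)) := by
    rw [← hYlaw, ← hmap, integral_map hpm]
    · simp only [hZeq]
    · exact (hg'.comp hmeas).aestronglyMeasurable
  rw [e1, e2, integral_prod_symm, integral_prod_symm]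
  -- For a frozen residual `w` this is the one-dimensional Stein identity in `y`. The chain rule
  -- gives a factor `1 / v`, which cancels the variance and explains the constant `max C (C / v)`.
  · congr with w
    have hder (y : ℝ) : HasDerivAt (fun y => g (w + (y / v) • c)) (g' (w + (y / v) • c) / v) y := by
      have h0 := hd (w + (y / v) • c)
      have h1 : HasDerivAt (fun y' : ℝ => (y' - y) / v) (1 / v) y :=
        ((hasDerivAt_id y).sub_const y).div_const v
      have h2 : HasDerivAt (fun t : ℝ => g (w + (y / v) • c + t • c)) (g' (w + (y / v) • c))
          ((fun y' : ℝ => (y' - y) / v) y) := by simpa using h0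
      have h3 := h2.comp y h1
      convert! h3 using 1
      · ext y'
        simp only [Function.comp]
        congr 1
        rw [add_assoc, ← add_smul]
        congr 2; ring
      · ring
    have hs := integral_mul_gaussianReal (C := max C (C / v)) v.toNNReal hder
      (fun y => (hb _).trans (le_max_left _ _)) (fun y => by
        rw [abs_div, abs_of_pos hvpos]
        exact (div_le_div_of_nonneg_right (hb' _) hvpos.le).trans (le_max_right _ _))
    rw [hs, Real.coe_toNNReal _ hvpos.le, integral_div]
    field_simp
  · refine Integrable.of_bound (hg'.comp hmeas).aestronglyMeasurable C (ae_of_all _ fun q => hb' _)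
  · have := (hYint.comp_fst (P.map W)).bdd_mul (c := C) (f := fun q : ℝ × (ι → ℝ) => g (q.2 + (q.1 / v) • c))
      (hg.comp hmeas).aestronglyMeasurable (ae_of_all _ fun q => hb _)
    simpa [mul_comm] using this

/-! ### Bivariate Gaussian vectors -/

/-- Linear regression in a standard bivariate Gaussian vector. -/
lemma map_prodMk_sub_mul {A B : Ω → ℝ} {r : ℝ} (hAB : HasGaussianLaw (fun ω => (A ω, B ω)) P)
    (hA : ∫ ω, A ω ∂P = 0) (hB : ∫ ω, B ω ∂P = 0) (hvA : Var[A; P] = 1) (hvB : Var[B; P] = 1)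
    (hr : cov[A, B; P] = r) :
    P.map (fun ω => (A ω, B ω - r * A ω)) =
      (gaussianReal 0 1).prod (gaussianReal 0 (1 - r ^ 2).toNNReal) := by
  have := hAB.isProbabilityMeasure
  have hAg : HasGaussianLaw A P := hAB.fst
  have hBg : HasGaussianLaw B P := hAB.snd
  have hg : HasGaussianLaw (fun ω => (A ω, B ω - r * A ω)) P := by
    have := hAB.map_fun ((ContinuousLinearMap.fst ℝ ℝ ℝ).prod
      (ContinuousLinearMap.snd ℝ ℝ ℝ - r • ContinuousLinearMap.fst ℝ ℝ ℝ))
    simpa using this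
  have hAm := hAg.memLp_two
  have hBm := hBg.memLp_two
  have hind : IndepFun A (fun ω => B ω - r * A ω) P := by
    refine hg.indepFun_of_covariance_eq_zero ?_
    rw [covariance_fun_sub_right hAm hBm (hAm.const_mul _), covariance_const_mul_right, hr,
      covariance_self hAg.aemeasurable, hvA]
    ring
  rw [hind.map_prod_eq_prod_map_map hAg.aemeasurable hg.snd.aemeasurable,
    hAg.map_eq_gaussianReal, hg.snd.map_eq_gaussianReal, hA, hvA]
  congr 2
  · simp
  · rw [integral_sub hBg.integrable (hAg.integrable.const_mul _), integral_const_mul, hA, hB]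
    simp
  · congr 1
    rw [← covariance_self hg.snd.aemeasurable,
      covariance_fun_sub_fun_sub hBm (hAm.const_mul _) hBm (hAm.const_mul _),
      covariance_const_mul_right, covariance_const_mul_left, covariance_const_mul_left,
      covariance_const_mul_right, covariance_self hAg.aemeasurable,
      covariance_self hBg.aemeasurable, hvA, hvB, covariance_comm B A, hr]
    ring

/-- The left side is the bivariate density at `(a, b)`, factored by regression. On the quadrant, `a²
- 2rab + b² ≥ 2v²(1 - |r|)`; division by `2(1 - r²)` leaves `v² / (1 + |r|)`. -/
lemma gaussianPDFReal_mul_le {r v a b : ℝ} (hr : |r| < 1) (hv : 0 ≤ v) (ha : v ≤ a) (hb : v ≤ b) :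
    gaussianPDFReal 0 1 a * gaussianPDFReal 0 (1 - r ^ 2).toNNReal (b - r * a) ≤
      1 / (2 * Real.pi * √(1 - r ^ 2)) * Real.exp (-v ^ 2 / (1 + |r|)) := by
  have h1 : 0 < 1 - r ^ 2 := by
    have := (sq_lt_one_iff_abs_lt_one r).2 hr
    linarith
  have hpi := Real.pi_pos
  simp only [gaussianPDFReal, Real.coe_toNNReal _ h1.le, NNReal.coe_one, mul_one, sub_zero]
  have e1 : (√(2 * Real.pi))⁻¹ * Real.exp (-a ^ 2 / 2) *
      ((√(2 * Real.pi * (1 - r ^ 2)))⁻¹ * Real.exp (-(b - r * a) ^ 2 / (2 * (1 - r ^ 2)))) =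
      1 / (2 * Real.pi * √(1 - r ^ 2)) *
        Real.exp (-(a ^ 2 - 2 * r * a * b + b ^ 2) / (2 * (1 - r ^ 2))) := by
    rw [Real.sqrt_mul (by positivity) (1 - r ^ 2)]
    have e2 : Real.exp (-(a ^ 2 - 2 * r * a * b + b ^ 2) / (2 * (1 - r ^ 2))) =
      Real.exp (-a ^ 2 / 2) * Real.exp (-(b - r * a) ^ 2 / (2 * (1 - r ^ 2))) := by
      rw [← Real.exp_add]
      congr 1
      field_simp; ring
    have e3 : √(2 * Real.pi) * √(2 * Real.pi) = 2 * Real.pi := Real.mul_self_sqrt (by positivity)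
    rw [e2]
    have hs : 0 < √(1 - r ^ 2) := Real.sqrt_pos.2 h1
    have hs2 : 0 < √(2 * Real.pi) := Real.sqrt_pos.2 (by positivity)
    field_simp
    rw [sq, e3]
  rw [e1]
  refine mul_le_mul_of_nonneg_left (Real.exp_le_exp.2 ?_) (by positivity)
  rw [div_le_div_iff₀ (by positivity) (by positivity)]
  have hr0 := abs_nonneg r
  have hrr : r ^ 2 = |r| ^ 2 := (sq_abs r).symm
  have hab : r * a * b ≤ |r| * (a * b) := by
    rw [mul_assoc]
    exact mul_le_mul_of_nonneg_right (le_abs_self r) (mul_nonneg (hv.trans ha) (hv.trans hb))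
  have hva : v ^ 2 ≤ a ^ 2 := by gcongr
  have hvb : v ^ 2 ≤ b ^ 2 := by gcongr
  have key : 2 * v ^ 2 * (1 - |r|) ≤ a ^ 2 - 2 * r * a * b + b ^ 2 := by
    nlinarith [mul_nonneg hr0 (sq_nonneg (a - b)),
      mul_le_mul_of_nonneg_right (add_le_add hva hvb) (sub_nonneg.2 hr.le)]
  rw [hrr]
  nlinarith [mul_le_mul_of_nonneg_right key (by positivity : 0 ≤ 1 + |r|)]

lemma lintegral_gaussianReal_mul_comp_add {r a : ℝ} {q : ℝ → ℝ≥0∞} (hq : Measurable q) {w : ℝ≥0}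
    (hw : w ≠ 0) :
    ∫⁻ x, q (x + r * a) ∂(gaussianReal 0 w) = ∫⁻ b, gaussianPDF 0 w (b - r * a) * q b := by
  rw [gaussianReal_of_var_ne_zero 0 hw,
    lintegral_withDensity_eq_lintegral_mul _ (measurable_gaussianPDF _ _) (by fun_prop),
    ← lintegral_add_right_eq_self (μ := volume) (fun b => gaussianPDF 0 w (b - r * a) * q b) (r * a)]
  simp

lemma lintegral_mul_mul_lintegral_mul_le {v : ℝ} {M : ℝ≥0∞} {f p q : ℝ → ℝ≥0∞}
    {k : ℝ → ℝ → ℝ≥0∞} (hf : ∀ a, f a ≠ ∞) (hk : ∀ a b, v ≤ a → v ≤ b → f a * k a b ≤ M)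
    (hp : Measurable p) (hq : Measurable q) (hp1 : ∫⁻ x, p x ≤ 1) (hq1 : ∫⁻ x, q x ≤ 1)
    (hps : ∀ x < v, p x = 0) (hqs : ∀ x < v, q x = 0) :
    ∫⁻ a, f a * (p a * ∫⁻ b, k a b * q b) ≤ M := by
  calc ∫⁻ a, f a * (p a * ∫⁻ b, k a b * q b)
      ≤ ∫⁻ a, p a * M := by
        refine lintegral_mono fun a => ?_
        rcases lt_or_ge a v with hav | hav
        · simp [hps a hav]
        rw [mul_left_comm]
        refine mul_le_mul_right ?_ _
        rw [← lintegral_const_mul' _ _ (hf a)]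
        calc ∫⁻ b, f a * (k a b * q b)
            ≤ ∫⁻ b, M * q b := by
              refine lintegral_mono fun b => ?_
              rcases lt_or_ge b v with hbv | hbv
              · simp [hqs b hbv]
              rw [← mul_assoc]
              exact mul_le_mul_left (hk a b hav hbv) _
          _ = M * ∫⁻ b, q b := lintegral_const_mul _ hq
          _ ≤ M * 1 := mul_le_mul_right hq1 _
          _ = M := mul_one M
    _ = (∫⁻ a, p a) * M := lintegral_mul_const _ hp
    _ ≤ 1 * M := mul_le_mul_left hp1 _
    _ = M := one_mul M

lemma lintegral_gaussianReal_mul_lintegral_le {r v : ℝ} (hr1 : |r| < 1) (hv : 0 ≤ v)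
    {p q : ℝ → ℝ≥0∞}
    (hp : Measurable p) (hq : Measurable q) (hp1 : ∫⁻ x, p x ≤ 1) (hq1 : ∫⁻ x, q x ≤ 1)
    (hps : ∀ x < v, p x = 0) (hqs : ∀ x < v, q x = 0) :
    ∫⁻ a, p a * ∫⁻ x, q (x + r * a) ∂(gaussianReal 0 (1 - r ^ 2).toNNReal) ∂(gaussianReal 0 1) ≤
      ENNReal.ofReal (1 / (2 * Real.pi * √(1 - r ^ 2)) * Real.exp (-v ^ 2 / (1 + |r|))) := by
  have h1 : 0 < 1 - r ^ 2 := by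
    have := (sq_lt_one_iff_abs_lt_one r).2 hr1
    linarith
  have hne : (1 - r ^ 2).toNNReal ≠ 0 := by simpa using h1
  simp_rw [lintegral_gaussianReal_mul_comp_add hq hne]
  have hk (a b : ℝ) (ha : v ≤ a) (hb : v ≤ b) :
      gaussianPDF 0 1 a * gaussianPDF 0 (1 - r ^ 2).toNNReal (b - r * a) ≤
      ENNReal.ofReal (1 / (2 * Real.pi * √(1 - r ^ 2)) * Real.exp (-v ^ 2 / (1 + |r|))) := by
    rw [gaussianPDF, gaussianPDF, ← ENNReal.ofReal_mul (gaussianPDFReal_nonneg _ _ _)]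
    exact ENNReal.ofReal_le_ofReal (gaussianPDFReal_mul_le hr1 hv ha hb)
  generalize (1 - r ^ 2).toNNReal = w at hk
  have hm : Measurable fun a => p a * ∫⁻ b, gaussianPDF 0 w (b - r * a) * q b := by
    refine hp.mul (Measurable.lintegral_prod_right'
      (f := fun x : ℝ × ℝ => gaussianPDF 0 w (x.2 - r * x.1) * q x.2) ?_)
    have := measurable_gaussianPDF 0 w
    fun_prop
  rw [gaussianReal_of_var_ne_zero 0 one_ne_zero,
    lintegral_withDensity_eq_lintegral_mul _ (measurable_gaussianPDF _ _) hm]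
  exact lintegral_mul_mul_lintegral_mul_le (fun a => gaussianPDF_ne_top) hk hp hq hp1 hq1 hps hqs

/-- If `p` and `q` are subprobability densities carried by `[v, ∞)` and `(A, B)` is a standard
bivariate Gaussian vector with correlation `r`, then `E[p(A) q(B)]` is at most the maximum of the
bivariate density over `[v, ∞)²`. -/
lemma lintegral_mul_le_of_support {A B : Ω → ℝ} {r v : ℝ}
    (hAB : HasGaussianLaw (fun ω => (A ω, B ω)) P)
    (hA : ∫ ω, A ω ∂P = 0) (hB : ∫ ω, B ω ∂P = 0) (hvA : Var[A; P] = 1) (hvB : Var[B; P] = 1)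
    (hr : cov[A, B; P] = r) (hr1 : |r| < 1) (hv : 0 ≤ v) {p q : ℝ → ℝ≥0∞}
    (hp : Measurable p) (hq : Measurable q) (hp1 : ∫⁻ x, p x ≤ 1) (hq1 : ∫⁻ x, q x ≤ 1)
    (hps : ∀ x < v, p x = 0) (hqs : ∀ x < v, q x = 0) :
    ∫⁻ ω, p (A ω) * q (B ω) ∂P ≤
      ENNReal.ofReal (1 / (2 * Real.pi * √(1 - r ^ 2)) * Real.exp (-v ^ 2 / (1 + |r|))) := by
  have hmap := map_prodMk_sub_mul hAB hA hB hvA hvB hr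
  have hmeas : AEMeasurable (fun ω => (A ω, B ω - r * A ω)) P := by
    have h2 := hAB.fst.aemeasurable
    have h3 := hAB.snd.aemeasurable
    fun_prop
  have e1 : ∫⁻ ω, p (A ω) * q (B ω) ∂P =
      ∫⁻ x, p x.1 * q (x.2 + r * x.1) ∂(P.map (fun ω => (A ω, B ω - r * A ω))) := by
    rw [lintegral_map' (by fun_prop) hmeas]
    simp
  rw [e1, hmap, lintegral_prod _ (by fun_prop)]
  have e2 (a : ℝ) := lintegral_const_mul (μ := gaussianReal 0 (1 - r ^ 2).toNNReal) (p a)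
    (hq.comp (measurable_id.add_const (r * a)))
  simp only [Function.comp, id] at e2
  simp only [e2]
  exact lintegral_gaussianReal_mul_lintegral_le hr1 hv hp hq hp1 hq1 hps hqs

/-- A decreasing `C¹` approximation from above of the indicator of `(-∞, u]`. -/
lemma exists_smooth_cutoff (u : ℝ) {ε : ℝ} (hε : 0 < ε) :
    ∃ φ φ' : ℝ → ℝ, (∀ x, HasDerivAt φ (φ' x) x) ∧ Continuous φ' ∧ (∃ C, ∀ x, |φ' x| ≤ C) ∧
      (∀ x, 0 ≤ φ x) ∧ (∀ x, φ x ≤ 1) ∧ (∀ x ≤ u, φ x = 1) ∧ (∀ x, u + ε ≤ x → φ x = 0) ∧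
      (∀ x < u, φ' x = 0) ∧ ∫⁻ x, ENNReal.ofReal |φ' x| ≤ 1 := by
  -- The argument of the transition is at least `1` for `x ≤ u` and at most `0` for `x ≥ u + ε`.
  set φ : ℝ → ℝ := fun x => Real.smoothTransition (1 + (u - x) / ε) with hφ
  have hcd : ContDiff ℝ 1 φ := by
    have : ContDiff ℝ 1 Real.smoothTransition := Real.smoothTransition.contDiff (n := 1)
    exact this.comp (by fun_prop)
  have hd (x : ℝ) : HasDerivAt φ (deriv φ x) x :=
    (hcd.differentiable one_ne_zero x).hasDerivAt
  have hcont : Continuous (deriv φ) := hcd.continuous_deriv le_rfl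
  have hone : ∀ x ≤ u, φ x = 1 := fun x hx =>
    Real.smoothTransition.one_of_one_le (by
      have : 0 ≤ (u - x) / ε := div_nonneg (by linarith) hε.le
      linarith)
  have hzero : ∀ x, u + ε ≤ x → φ x = 0 := fun x hx =>
    Real.smoothTransition.zero_of_nonpos (by
      have : (u - x) / ε ≤ -1 := by
        rw [div_le_iff₀ hε]; linarith
      linarith)
  have hleft : ∀ x < u, deriv φ x = 0 := fun x hx => by
    have : φ =ᶠ[𝓝 x] fun _ => 1 := by
      filter_upwards [Iio_mem_nhds hx] with y hy using hone y hy.le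
    rw [this.deriv_eq]; simp
  have hright : ∀ x, u + ε < x → deriv φ x = 0 := fun x hx => by
    have : φ =ᶠ[𝓝 x] fun _ => 0 := by
      filter_upwards [Ioi_mem_nhds hx] with y hy using hzero y (le_of_lt hy)
    rw [this.deriv_eq]; simp
  have hanti : Antitone φ := fun x y hxy => Real.smoothTransition.monotone (by gcongr)
  have hneg (x : ℝ) : deriv φ x ≤ 0 := hanti.deriv_nonpos
  have hcs : HasCompactSupport (deriv φ) := by
    refine HasCompactSupport.intro (K := Set.Icc u (u + ε)) isCompact_Icc fun x hx => ?_
    rw [Set.mem_Icc, not_and_or, not_le, not_le] at hx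
    exact hx.elim (hleft x) (hright x)
  have hint : Integrable (deriv φ) := hcont.integrable_of_hasCompactSupport hcs
  refine ⟨φ, deriv φ, hd, hcont, ?_, fun x => Real.smoothTransition.nonneg _,
    fun x => Real.smoothTransition.le_one _, hone, hzero, hleft, ?_⟩
  · obtain ⟨C, hC⟩ := hcs.exists_bound_of_continuous hcont
    exact ⟨C, hC⟩
  · rw [← ofReal_integral_eq_lintegral_ofReal hint.abs (ae_of_all _ fun x => abs_nonneg _)]
    -- Since `φ` decreases from `1` to `0`, the total mass of `|φ'|` is exactly `1`, whatever `ε`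
    -- is.
    have : ∫ x, deriv φ x = 0 - 1 := by
      refine integral_of_hasDerivAt_of_tendsto hd hint ?_ ?_
      · refine tendsto_const_nhds.congr' ?_
        filter_upwards [eventually_le_atBot u] with x hx using (hone x hx).symm
      · refine tendsto_const_nhds.congr' ?_
        filter_upwards [eventually_ge_atTop (u + ε)] with x hx using (hzero x hx).symm
    simp_rw [abs_of_nonpos (hneg _)]
    rw [integral_neg, this]
    simp

/-! ### The normal comparison inequality -/

section Comparison

variable {Ω : Type*} {ι : Type*}

/-- The interpolation `cos θ ξ + sin θ η`. -/
def interp (ξ η : ι → Ω → ℝ) (θ : ℝ) (i : ι) (ω : Ω) : ℝ :=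
  Real.cos θ * ξ i ω + Real.sin θ * η i ω

lemma interp_zero (ξ η : ι → Ω → ℝ) : interp ξ η 0 = ξ := by
  ext; simp [interp]

lemma interp_pi_div_two (ξ η : ι → Ω → ℝ) : interp ξ η (Real.pi / 2) = η := by
  ext; simp [interp]

lemma interp_add_pi_div_two (ξ η : ι → Ω → ℝ) (θ : ℝ) (i : ι) (ω : Ω) :
    interp ξ η (θ + Real.pi / 2) i ω = -Real.sin θ * ξ i ω + Real.cos θ * η i ω := by
  simp [interp, Real.cos_add_pi_div_two, Real.sin_add_pi_div_two]

/-- Differentiating the rotation in `θ` advances it by a quarter turn, so the velocity is again an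
interpolation and `covariance_interp` applies to it. -/
lemma hasDerivAt_interp (ξ η : ι → Ω → ℝ) (θ : ℝ) (i : ι) (ω : Ω) :
    HasDerivAt (fun θ => interp ξ η θ i ω) (interp ξ η (θ + Real.pi / 2) i ω) θ := by
  rw [interp_add_pi_div_two]
  exact ((Real.hasDerivAt_cos θ).mul_const _).add ((Real.hasDerivAt_sin θ).mul_const _)

lemma abs_interp_le (ξ η : ι → Ω → ℝ) (θ : ℝ) (i : ι) (ω : Ω) :
    |interp ξ η θ i ω| ≤ |ξ i ω| + |η i ω| := by
  refine (abs_add_le _ _).trans (add_le_add ?_ ?_)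
  · rw [abs_mul]
    exact mul_le_of_le_one_left (abs_nonneg _) (Real.abs_cos_le_one θ)
  · rw [abs_mul]
    exact mul_le_of_le_one_left (abs_nonneg _) (Real.abs_sin_le_one θ)

lemma abs_prod_le_one {φ : ι → ℝ → ℝ} (h0 : ∀ i x, 0 ≤ φ i x) (h1 : ∀ i x, φ i x ≤ 1)
    (s : Finset ι) (z : ι → ℝ) : |∏ i ∈ s, φ i (z i)| ≤ 1 := by
  rw [abs_of_nonneg (Finset.prod_nonneg fun i _ => h0 i _)]
  exact Finset.prod_le_one (fun i _ => h0 i _) fun i _ => h1 i _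

variable [MeasurableSpace Ω] {P : Measure Ω} [Fintype ι] {ξ η : ι → Ω → ℝ}

lemma hasGaussianLaw_interp_prodMk
    (hg : HasGaussianLaw (fun ω => ((fun i => ξ i ω), fun i => η i ω)) P) (θ θ' : ℝ) (i : ι) :
    HasGaussianLaw (fun ω => (interp ξ η θ' i ω, fun j => interp ξ η θ j ω)) P := by
  have := hg.map_fun
    (((Real.cos θ' • (ContinuousLinearMap.proj (R := ℝ) (φ := fun _ : ι => ℝ) i).comp
          (ContinuousLinearMap.fst ℝ (ι → ℝ) (ι → ℝ))) +
        (Real.sin θ' • (ContinuousLinearMap.proj (R := ℝ) (φ := fun _ : ι => ℝ) i).comp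
          (ContinuousLinearMap.snd ℝ (ι → ℝ) (ι → ℝ)))).prod
      (Real.cos θ • ContinuousLinearMap.fst ℝ (ι → ℝ) (ι → ℝ) +
        Real.sin θ • ContinuousLinearMap.snd ℝ (ι → ℝ) (ι → ℝ)))
  exact this

lemma covariance_interp
    (hg : HasGaussianLaw (fun ω => ((fun i => ξ i ω), fun i => η i ω)) P)
    (hξη : ∀ i j, cov[ξ i, η j; P] = 0) (θ θ' : ℝ) (i j : ι) :
    cov[interp ξ η θ i, interp ξ η θ' j; P] =
      Real.cos θ * Real.cos θ' * cov[ξ i, ξ j; P] + Real.sin θ * Real.sin θ' * cov[η i, η j; P] := by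
  have := hg.isProbabilityMeasure
  have hξ (i : ι) : MemLp (ξ i) 2 P := (hg.fst.eval i).memLp_two
  have hη (i : ι) : MemLp (η i) 2 P := (hg.snd.eval i).memLp_two
  have e (θ : ℝ) (i : ι) : interp ξ η θ i = Real.cos θ • ξ i + Real.sin θ • η i := by
    ext; simp [interp]
  rw [e, e, covariance_add_left ((hξ i).const_smul _) ((hη i).const_smul _)
      (((hξ j).const_smul _).add ((hη j).const_smul _)),
    covariance_add_right ((hξ i).const_smul _) ((hξ j).const_smul _) ((hη j).const_smul _),
    covariance_add_right ((hη i).const_smul _) ((hξ j).const_smul _) ((hη j).const_smul _)]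
  simp only [covariance_smul_left, covariance_smul_right, hξη, covariance_comm (η i) (ξ j)]
  ring

lemma integral_interp
    (hg : HasGaussianLaw (fun ω => ((fun i => ξ i ω), fun i => η i ω)) P)
    (hξ0 : ∀ i, ∫ ω, ξ i ω ∂P = 0) (hη0 : ∀ i, ∫ ω, η i ω ∂P = 0) (θ : ℝ) (i : ι) :
    ∫ ω, interp ξ η θ i ω ∂P = 0 := by
  simp only [interp]
  rw [integral_add ((hg.fst.eval i).integrable.const_mul _)
    ((hg.snd.eval i).integrable.const_mul _), integral_const_mul, integral_const_mul, hξ0, hη0]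
  simp

/-- When `η i` and `η j` are uncorrelated, the interpolated correlation is `cos² θ` times that of
`ξ`. The density bound, which grows with `|r|`, therefore holds uniformly in `θ`. -/
lemma integral_abs_mul_abs_interp_le {σ v : ℝ} {φ' : ι → ℝ → ℝ}
    (hg : HasGaussianLaw (fun ω => ((fun i => ξ i ω), fun i => η i ω)) P)
    (hξ0 : ∀ i, ∫ ω, ξ i ω ∂P = 0) (hη0 : ∀ i, ∫ ω, η i ω ∂P = 0)
    (hξ1 : ∀ i, Var[ξ i; P] = 1) (hη1 : ∀ i, Var[η i; P] = 1)
    (hξη : ∀ i j, cov[ξ i, η j; P] = 0) (hc : ∀ i, Continuous (φ' i))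
    (hv : 0 ≤ v) (hs : ∀ i, ∀ x < v, φ' i x = 0)
    (hI : ∀ i, ∫⁻ x, ENNReal.ofReal |φ' i x| ≤ 1) (θ : ℝ) {i j : ι}
    (hηij : cov[η i, η j; P] = 0) (hξij : |cov[ξ i, ξ j; P]| ≤ σ) (hσ : σ < 1) :
    ∫ ω, |φ' i (interp ξ η θ i ω)| * |φ' j (interp ξ η θ j ω)| ∂P ≤
      1 / (2 * Real.pi * √(1 - σ ^ 2)) * Real.exp (-v ^ 2 / (1 + |cov[ξ i, ξ j; P]|)) := by
  have hvar (i : ι) : Var[interp ξ η θ i; P] = 1 := by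
    have hgi : HasGaussianLaw (interp ξ η θ i) P := (hasGaussianLaw_interp_prodMk hg θ θ i).fst
    rw [← covariance_self hgi.aemeasurable, covariance_interp hg hξη,
      covariance_self (hg.fst.eval i).aemeasurable, covariance_self (hg.snd.eval i).aemeasurable,
      hξ1, hη1]
    linarith [Real.sin_sq_add_cos_sq θ, sq (Real.sin θ), sq (Real.cos θ)]
  have hgij : HasGaussianLaw (fun ω => (interp ξ η θ i ω, interp ξ η θ j ω)) P :=
    (hasGaussianLaw_interp_prodMk hg θ θ i).snd.prodMk i j
  set r := cov[interp ξ η θ i, interp ξ η θ j; P] with hr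
  have hrle : |r| ≤ |cov[ξ i, ξ j; P]| := by
    rw [hr, covariance_interp hg hξη, hηij, mul_zero, add_zero, abs_mul]
    refine mul_le_of_le_one_left (abs_nonneg _) ?_
    rw [← sq, abs_of_nonneg (sq_nonneg _)]
    exact Real.cos_sq_le_one θ
  have hr1 : |r| < 1 := (hrle.trans hξij).trans_lt hσ
  have key := lintegral_mul_le_of_support hgij (integral_interp hg hξ0 hη0 _ i)
    (integral_interp hg hξ0 hη0 _ j) (hvar i) (hvar j) hr.symm hr1 hv
    (p := fun x => ENNReal.ofReal |φ' i x|) (q := fun x => ENNReal.ofReal |φ' j x|)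
    (hc i).abs.measurable.ennreal_ofReal (hc j).abs.measurable.ennreal_ofReal (hI i) (hI j)
    (fun x hx => by simp [hs i x hx]) (fun x hx => by simp [hs j x hx])
  have hσ2 : 0 < 1 - σ ^ 2 := by
    have : σ ^ 2 < 1 := (sq_lt_one_iff_abs_lt_one σ).2
      (by rwa [abs_of_nonneg ((abs_nonneg _).trans hξij)])
    linarith
  have hmono : 1 / (2 * Real.pi * √(1 - r ^ 2)) * Real.exp (-v ^ 2 / (1 + |r|)) ≤
      1 / (2 * Real.pi * √(1 - σ ^ 2)) * Real.exp (-v ^ 2 / (1 + |cov[ξ i, ξ j; P]|)) := by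
    have hsq : r ^ 2 ≤ σ ^ 2 := by
      rw [← sq_abs r]
      have := hrle.trans hξij
      gcongr
    have := Real.pi_pos
    refine mul_le_mul ?_ (Real.exp_le_exp.2 ?_) (Real.exp_pos _).le (by positivity)
    · have : 0 < √(1 - σ ^ 2) := Real.sqrt_pos.2 hσ2
      gcongr
    · rw [neg_div, neg_div, neg_le_neg_iff]
      gcongr
  rw [integral_eq_lintegral_of_nonneg_ae (ae_of_all _ fun ω => by positivity)]
  · refine ENNReal.toReal_le_of_le_ofReal (by positivity) (le_trans (le_of_eq ?_)
      (key.trans (ENNReal.ofReal_le_ofReal hmono)))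
    exact lintegral_congr fun ω => ENNReal.ofReal_mul (abs_nonneg _)
  · refine AEMeasurable.aestronglyMeasurable ?_
    exact ((hc i).abs.measurable.comp_aemeasurable hgij.fst.aemeasurable).mul
      ((hc j).abs.measurable.comp_aemeasurable hgij.snd.aemeasurable)

/-- The cutoffs equal `1` on the closed half-lines and their transition zone shrinks to nothing on
the outside, so the product converges at every point and no boundary need be discarded as a null
set. -/
lemma tendsto_integral_prod_cutoff [IsProbabilityMeasure P] {u : ι → ℝ} {φ : ℕ → ι → ℝ → ℝ}
    (hφ : ∀ m i, Continuous (φ m i)) (h0 : ∀ m i x, 0 ≤ φ m i x) (h1 : ∀ m i x, φ m i x ≤ 1)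
    (hone : ∀ m i, ∀ x ≤ u i, φ m i x = 1)
    (hzero : ∀ (m : ℕ) i x, u i + 1 / ((m : ℝ) + 1) ≤ x → φ m i x = 0) (hξ : ∀ i, Measurable (ξ i)) :
    Tendsto (fun m => ∫ ω, ∏ i, φ m i (ξ i ω) ∂P) atTop (𝓝 (P.real {ω | ∀ i, ξ i ω ≤ u i})) := by
  have hms : MeasurableSet {ω | ∀ i, ξ i ω ≤ u i} := by
    rw [Set.ofPred_forall]
    exact MeasurableSet.iInter fun i => measurableSet_le (hξ i) measurable_const
  have hmem (ω : Ω) : ω ∈ {ω | ∀ i, ξ i ω ≤ u i} ↔ ∀ i, ξ i ω ≤ u i := Iff.rfl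
  rw [← integral_indicator_one hms]
  refine tendsto_integral_of_dominated_convergence (fun _ => 1) (fun m => ?_) (integrable_const 1)
    (fun m => ae_of_all _ fun ω => abs_prod_le_one (h0 m) (h1 m) _ _) (ae_of_all _ fun ω => ?_)
  · exact (Finset.measurable_fun_prod _ fun i _ =>
      (hφ m i).measurable.comp (hξ i)).aestronglyMeasurable
  · by_cases hω : ∀ i, ξ i ω ≤ u i
    · rw [Set.indicator_of_mem ((hmem ω).2 hω)]
      refine tendsto_const_nhds.congr fun m => ?_
      rw [Finset.prod_eq_one fun i _ => hone m i _ (hω i)]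
      rfl
    · rw [Set.indicator_of_notMem (mt (hmem ω).1 hω)]
      push Not at hω
      obtain ⟨i, hi⟩ := hω
      refine tendsto_const_nhds.congr' ?_
      have : ∀ᶠ m : ℕ in atTop, 1 / ((m : ℝ) + 1) < ξ i ω - u i :=
        (tendsto_one_div_add_atTop_nhds_zero_nat).eventually_lt_const (sub_pos.2 hi)
      filter_upwards [this] with m hm
      exact (Finset.prod_eq_zero (Finset.mem_univ i) (hzero m i _ (by linarith))).symm

variable [DecidableEq ι] {φ φ' : ι → ℝ → ℝ} {C : ℝ}

/-- Differentiation under the integral: the summands are bounded by `(|ξ i| + |η i|) * C`, which is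
integrable and independent of `θ`. -/
lemma hasDerivAt_integral_prod_interp
    (hg : HasGaussianLaw (fun ω => ((fun i => ξ i ω), fun i => η i ω)) P)
    (hd : ∀ i x, HasDerivAt (φ i) (φ' i x) x) (hc : ∀ i, Continuous (φ' i))
    (hC : ∀ i x, |φ' i x| ≤ C) (h0 : ∀ i x, 0 ≤ φ i x) (h1 : ∀ i x, φ i x ≤ 1) (θ : ℝ) :
    HasDerivAt (fun θ => ∫ ω, ∏ i, φ i (interp ξ η θ i ω) ∂P)
      (∑ i, ∫ ω, interp ξ η (θ + Real.pi / 2) i ω *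
        (φ' i (interp ξ η θ i ω) * ∏ j ∈ Finset.univ.erase i, φ j (interp ξ η θ j ω)) ∂P) θ := by
  have := hg.isProbabilityMeasure
  have hξ (i : ι) : HasGaussianLaw (ξ i) P := hg.fst.eval i
  have hη (i : ι) : HasGaussianLaw (η i) P := hg.snd.eval i
  have hm (θ : ℝ) (i : ι) : AEMeasurable (fun ω => interp ξ η θ i ω) P :=
    ((hξ i).aemeasurable.const_mul _).add ((hη i).aemeasurable.const_mul _)
  have hφc (i : ι) : Continuous (φ i) :=
    continuous_iff_continuousAt.2 fun x => (hd i x).continuousAt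
  have hφm (θ : ℝ) (i : ι) : AEMeasurable (fun ω => φ i (interp ξ η θ i ω)) P :=
    (hφc i).measurable.comp_aemeasurable (hm θ i)
  have hFm (θ : ℝ) (s : Finset ι) :
      AEMeasurable (fun ω => ∏ i ∈ s, φ i (interp ξ η θ i ω)) P :=
    Finset.aemeasurable_fun_prod s fun i _ => hφm θ i
  have htm (θ : ℝ) (i : ι) : AEMeasurable (fun ω => interp ξ η (θ + Real.pi / 2) i ω *
      (φ' i (interp ξ η θ i ω) * ∏ j ∈ Finset.univ.erase i, φ j (interp ξ η θ j ω))) P :=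
    (hm _ i).mul (((hc i).measurable.comp_aemeasurable (hm θ i)).mul (hFm θ _))
  have hterm (θ : ℝ) (i : ι) (ω : Ω) : |interp ξ η (θ + Real.pi / 2) i ω *
      (φ' i (interp ξ η θ i ω) * ∏ j ∈ Finset.univ.erase i, φ j (interp ξ η θ j ω))| ≤
      (|ξ i ω| + |η i ω|) * C := by
    rw [abs_mul, abs_mul]
    refine mul_le_mul (abs_interp_le _ _ _ _ _) ?_ (by positivity) (by positivity)
    exact (mul_le_of_le_one_right (abs_nonneg _) (abs_prod_le_one h0 h1 _ _)).trans (hC i _)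
  have hint (i : ι) : Integrable (fun ω => (|ξ i ω| + |η i ω|) * C) P :=
    ((hξ i).integrable.abs.add (hη i).integrable.abs).mul_const C
  have hti (θ : ℝ) (i : ι) : Integrable (fun ω => interp ξ η (θ + Real.pi / 2) i ω *
      (φ' i (interp ξ η θ i ω) * ∏ j ∈ Finset.univ.erase i, φ j (interp ξ η θ j ω))) P :=
    (hint i).mono' (htm θ i).aestronglyMeasurable (ae_of_all _ fun ω => hterm θ i ω)
  have key := hasDerivAt_integral_of_dominated_loc_of_deriv_le (μ := P) (x₀ := θ) (s := Set.univ)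
    (F := fun θ ω => ∏ i, φ i (interp ξ η θ i ω))
    (F' := fun θ ω => ∑ i, interp ξ η (θ + Real.pi / 2) i ω *
        (φ' i (interp ξ η θ i ω) * ∏ j ∈ Finset.univ.erase i, φ j (interp ξ η θ j ω)))
    (bound := fun ω => ∑ i, (|ξ i ω| + |η i ω|) * C) univ_mem
    (Eventually.of_forall fun θ => (hFm θ _).aestronglyMeasurable)
    (Integrable.of_bound (hFm θ _).aestronglyMeasurable 1
      (ae_of_all _ fun ω => abs_prod_le_one h0 h1 _ _))
    (Finset.aemeasurable_fun_sum _ fun i _ => htm θ i).aestronglyMeasurable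
    (ae_of_all _ fun ω θ _ => (Finset.abs_sum_le_sum_abs _ _).trans
      (Finset.sum_le_sum fun i _ => hterm θ i ω))
    (integrable_finsetSum _ fun i _ => hint i)
    (ae_of_all _ fun ω θ _ => by
      have := HasDerivAt.fun_finsetProd (u := Finset.univ) (x := θ)
        (f := fun i θ => φ i (interp ξ η θ i ω))
        (f' := fun i => φ' i (interp ξ η θ i ω) * interp ξ η (θ + Real.pi / 2) i ω)
        fun i _ => (hd i _).comp θ (hasDerivAt_interp ξ η θ i ω)
      convert! this using 1
      refine Finset.sum_congr rfl fun i _ => ?_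
      simp only [smul_eq_mul]; ring)
  have h2 := key.2
  rwa [integral_finsetSum _ fun i _ => hti θ i] at h2

/-- Gaussian integration by parts for one term of the derivative of the interpolated integral. -/
lemma integral_interp_mul_prod
    (hg : HasGaussianLaw (fun ω => ((fun i => ξ i ω), fun i => η i ω)) P)
    (hξ0 : ∀ i, ∫ ω, ξ i ω ∂P = 0) (hη0 : ∀ i, ∫ ω, η i ω ∂P = 0)
    (hξη : ∀ i j, cov[ξ i, η j; P] = 0) (hdiag : ∀ i, cov[ξ i, ξ i; P] = cov[η i, η i; P])
    (hd : ∀ i x, HasDerivAt (φ i) (φ' i x) x) (hc : ∀ i, Continuous (φ' i))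
    (hC : ∀ i x, |φ' i x| ≤ C) (h0 : ∀ i x, 0 ≤ φ i x) (h1 : ∀ i x, φ i x ≤ 1) (θ : ℝ) (i : ι) :
    ∫ ω, interp ξ η (θ + Real.pi / 2) i ω *
        (φ' i (interp ξ η θ i ω) * ∏ j ∈ Finset.univ.erase i, φ j (interp ξ η θ j ω)) ∂P =
    ∫ ω, φ' i (interp ξ η θ i ω) * ∑ j ∈ Finset.univ.erase i,
      (∏ k ∈ (Finset.univ.erase i).erase j, φ k (interp ξ η θ k ω)) *
        (φ' j (interp ξ η θ j ω) *
          cov[interp ξ η (θ + Real.pi / 2) i, interp ξ η θ j; P]) ∂P := by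
  set c : ι → ℝ := fun j => cov[interp ξ η (θ + Real.pi / 2) i, interp ξ η θ j; P] with hcdef
  -- Equal variances make the velocity of coordinate `i` uncorrelated with its position. Hence the
  -- direction `c` never differentiates `φ' i`, and `C¹` cutoffs suffice.
  have hci : c i = 0 := by
    simp only [hcdef]
    rw [covariance_interp hg hξη, hdiag, Real.cos_add_pi_div_two, Real.sin_add_pi_div_two]
    ring
  have hφc (i : ι) : Continuous (φ i) :=
    continuous_iff_continuousAt.2 fun x => (hd i x).continuousAt
  have hC0 : 0 ≤ C := (abs_nonneg _).trans (hC i 0)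
  refine integral_mul_comp_eq_integral_deriv (c := c) (C := max C (C * ∑ j, C * |c j|))
    (g := fun z => φ' i (z i) * ∏ j ∈ Finset.univ.erase i, φ j (z j))
    (g' := fun z => φ' i (z i) * ∑ j ∈ Finset.univ.erase i,
      (∏ k ∈ (Finset.univ.erase i).erase j, φ k (z k)) * (φ' j (z j) * c j))
    (hasGaussianLaw_interp_prodMk hg θ (θ + Real.pi / 2) i) (integral_interp hg hξ0 hη0 _ i)
    (fun j => rfl) ?_ ?_ ?_ ?_ ?_
  · exact Continuous.measurable (by fun_prop)
  · exact Continuous.measurable (by fun_prop)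
  · intro z
    have hprod := HasDerivAt.fun_finsetProd (u := Finset.univ.erase i) (x := (0 : ℝ))
        (f := fun j t => φ j (z j + t * c j)) (f' := fun j => φ' j (z j) * c j) fun j _ => by
      have hlin : HasDerivAt (fun t : ℝ => z j + t * c j) (c j) 0 := by
        simpa using ((hasDerivAt_id (0 : ℝ)).mul_const (c j)).const_add (z j)
      have hj : HasDerivAt (φ j) (φ' j (z j)) ((fun t : ℝ => z j + t * c j) 0) := by
        simpa using hd j (z j)
      exact hj.comp 0 hlin
    have := hprod.const_mul (φ' i (z i))
    simp only [zero_mul, add_zero, smul_eq_mul] at this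
    simpa [hci] using this
  · intro z
    rw [abs_mul]
    exact (mul_le_of_le_one_right (abs_nonneg _) (abs_prod_le_one h0 h1 _ _)).trans
      ((hC i _).trans (le_max_left _ _))
  · intro z
    refine le_trans ?_ (le_max_right _ _)
    rw [abs_mul]
    refine mul_le_mul (hC i _) ?_ (abs_nonneg _) hC0
    refine (Finset.abs_sum_le_sum_abs _ _).trans ?_
    refine (Finset.sum_le_sum (g := fun j => C * |c j|) fun j _ => ?_).trans
      (Finset.sum_le_sum_of_subset_of_nonneg (Finset.subset_univ _) fun j _ _ => by positivity)
    rw [abs_mul, abs_mul]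
    exact (mul_le_of_le_one_left (by positivity) (abs_prod_le_one h0 h1 _ _)).trans
      (mul_le_mul_of_nonneg_right (hC j _) (abs_nonneg _))

/-- The normal comparison inequality for products of smooth cutoffs. -/
lemma abs_integral_prod_sub_le {σ v : ℝ}
    (hg : HasGaussianLaw (fun ω => ((fun i => ξ i ω), fun i => η i ω)) P)
    (hξ0 : ∀ i, ∫ ω, ξ i ω ∂P = 0) (hη0 : ∀ i, ∫ ω, η i ω ∂P = 0)
    (hξ1 : ∀ i, Var[ξ i; P] = 1) (hη1 : ∀ i, Var[η i; P] = 1)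
    (hξη : ∀ i j, cov[ξ i, η j; P] = 0)
    (hcov : ∀ i j, i ≠ j → cov[ξ i, ξ j; P] = cov[η i, η j; P] ∨
      (cov[η i, η j; P] = 0 ∧ |cov[ξ i, ξ j; P]| ≤ σ)) (hσ : σ < 1)
    (hd : ∀ i x, HasDerivAt (φ i) (φ' i x) x) (hc : ∀ i, Continuous (φ' i))
    (hC : ∀ i x, |φ' i x| ≤ C) (h0 : ∀ i x, 0 ≤ φ i x) (h1 : ∀ i x, φ i x ≤ 1)
    (hv : 0 ≤ v) (hs : ∀ i, ∀ x < v, φ' i x = 0)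
    (hI : ∀ i, ∫⁻ x, ENNReal.ofReal |φ' i x| ≤ 1) :
    |∫ ω, ∏ i, φ i (η i ω) ∂P - ∫ ω, ∏ i, φ i (ξ i ω) ∂P| ≤
      (∑ i, ∑ j ∈ Finset.univ.erase i, |cov[ξ i, ξ j; P] - cov[η i, η j; P]| *
        (1 / (2 * Real.pi * √(1 - σ ^ 2)) * Real.exp (-v ^ 2 / (1 + |cov[ξ i, ξ j; P]|)))) *
      (Real.pi / 2) := by
  have := hg.isProbabilityMeasure
  have hdiag (i : ι) : cov[ξ i, ξ i; P] = cov[η i, η i; P] := by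
    rw [covariance_self (hg.fst.eval i).aemeasurable, covariance_self (hg.snd.eval i).aemeasurable,
      hξ1, hη1]
  -- Mean value inequality in the angle: the derivative bound does not depend on `θ`, so the path
  -- from `0` to `π / 2` costs only a factor `π / 2`.
  have key := Convex.norm_image_sub_le_of_norm_hasDerivWithin_le (s := Set.univ)
    (f := fun θ => ∫ ω, ∏ i, φ i (interp ξ η θ i ω) ∂P) (x := 0) (y := Real.pi / 2)
    (C := ∑ i, ∑ j ∈ Finset.univ.erase i, |cov[ξ i, ξ j; P] - cov[η i, η j; P]| *
        (1 / (2 * Real.pi * √(1 - σ ^ 2)) * Real.exp (-v ^ 2 / (1 + |cov[ξ i, ξ j; P]|))))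
    (fun θ _ => (hasDerivAt_integral_prod_interp hg hd hc hC h0 h1 θ).hasDerivWithinAt) ?_
    convex_univ (Set.mem_univ _) (Set.mem_univ _)
  · simp only [interp_zero, interp_pi_div_two, Real.norm_eq_abs, sub_zero] at key
    rwa [abs_of_pos (by positivity : 0 < Real.pi / 2)] at key
  intro θ _
  refine (Finset.abs_sum_le_sum_abs _ _).trans (Finset.sum_le_sum fun i _ => ?_)
  rw [integral_interp_mul_prod hg hξ0 hη0 hξη hdiag hd hc hC h0 h1 θ i]
  have hm (i : ι) : AEMeasurable (fun ω => interp ξ η θ i ω) P :=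
    (hasGaussianLaw_interp_prodMk hg θ θ i).fst.aemeasurable
  have hm' (i : ι) : AEMeasurable (fun ω => φ' i (interp ξ η θ i ω)) P :=
    (hc i).measurable.comp_aemeasurable (hm i)
  have hint (i j : ι) :
      Integrable (fun ω => |φ' i (interp ξ η θ i ω)| * |φ' j (interp ξ η θ j ω)|) P := by
    refine Integrable.of_bound ((hm' i).abs.mul (hm' j).abs).aestronglyMeasurable (C * C)
      (ae_of_all _ fun ω => ?_)
    rw [Real.norm_eq_abs, abs_mul, abs_abs, abs_abs]
    exact mul_le_mul (hC i _) (hC j _) (abs_nonneg _) ((abs_nonneg _).trans (hC i 0))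
  have hcd (j : ι) : |cov[interp ξ η (θ + Real.pi / 2) i, interp ξ η θ j; P]| ≤
      |cov[ξ i, ξ j; P] - cov[η i, η j; P]| := by
    rw [covariance_interp hg hξη, Real.cos_add_pi_div_two, Real.sin_add_pi_div_two,
      show -Real.sin θ * Real.cos θ * cov[ξ i, ξ j; P] + Real.cos θ * Real.sin θ * cov[η i, η j; P]
        = -(Real.sin θ * Real.cos θ) * (cov[ξ i, ξ j; P] - cov[η i, η j; P]) by ring, abs_mul]
    refine mul_le_of_le_one_left (abs_nonneg _) ?_
    rw [abs_neg, abs_mul]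
    exact mul_le_one₀ (Real.abs_sin_le_one θ) (abs_nonneg _) (Real.abs_cos_le_one θ)
  calc |∫ ω, φ' i (interp ξ η θ i ω) * ∑ j ∈ Finset.univ.erase i,
      (∏ k ∈ (Finset.univ.erase i).erase j, φ k (interp ξ η θ k ω)) *
        (φ' j (interp ξ η θ j ω) *
          cov[interp ξ η (θ + Real.pi / 2) i, interp ξ η θ j; P]) ∂P|
      ≤ ∫ ω, ∑ j ∈ Finset.univ.erase i, |cov[ξ i, ξ j; P] - cov[η i, η j; P]| *
          (|φ' i (interp ξ η θ i ω)| * |φ' j (interp ξ η θ j ω)|) ∂P := by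
        rw [← Real.norm_eq_abs]
        refine norm_integral_le_of_norm_le (integrable_finsetSum _ fun j _ =>
          (hint i j).const_mul _) (ae_of_all _ fun ω => ?_)
        rw [Real.norm_eq_abs, Finset.mul_sum]
        refine (Finset.abs_sum_le_sum_abs _ _).trans (Finset.sum_le_sum fun j _ => ?_)
        rw [abs_mul, abs_mul, abs_mul]
        calc _ ≤ |φ' i (interp ξ η θ i ω)| * (1 * (|φ' j (interp ξ η θ j ω)| *
              |cov[ξ i, ξ j; P] - cov[η i, η j; P]|)) := by
              refine mul_le_mul_of_nonneg_left (mul_le_mul (abs_prod_le_one h0 h1 _ _)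
                (mul_le_mul_of_nonneg_left (hcd j) (abs_nonneg _)) (by positivity) zero_le_one)
                (abs_nonneg _)
          _ = _ := by ring
    _ = ∑ j ∈ Finset.univ.erase i, |cov[ξ i, ξ j; P] - cov[η i, η j; P]| *
          ∫ ω, |φ' i (interp ξ η θ i ω)| * |φ' j (interp ξ η θ j ω)| ∂P := by
        rw [integral_finsetSum _ fun j _ => (hint i j).const_mul _]
        simp_rw [integral_const_mul]
    _ ≤ _ := by
        refine Finset.sum_le_sum fun j hj => ?_
        rcases hcov i j (Finset.ne_of_mem_erase hj).symm with h | ⟨h2, h3⟩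
        · simp [h]
        · exact mul_le_mul_of_nonneg_left (integral_abs_mul_abs_interp_le hg hξ0 hη0 hξ1 hη1 hξη hc
            hv hs hI θ h2 h3 hσ) (abs_nonneg _)

/-- The normal comparison inequality: `ξ` and `η` are uncorrelated standard Gaussian vectors, and
whenever a correlation of `η` differs from that of `ξ` it vanishes. -/
theorem abs_measureReal_sub_le {σ v : ℝ} {u : ι → ℝ}
    (hg : HasGaussianLaw (fun ω => ((fun i => ξ i ω), fun i => η i ω)) P)
    (hξm : ∀ i, Measurable (ξ i)) (hηm : ∀ i, Measurable (η i))
    (hξ0 : ∀ i, ∫ ω, ξ i ω ∂P = 0) (hη0 : ∀ i, ∫ ω, η i ω ∂P = 0)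
    (hξ1 : ∀ i, Var[ξ i; P] = 1) (hη1 : ∀ i, Var[η i; P] = 1)
    (hξη : ∀ i j, cov[ξ i, η j; P] = 0)
    (hcov : ∀ i j, i ≠ j → cov[ξ i, ξ j; P] = cov[η i, η j; P] ∨
      (cov[η i, η j; P] = 0 ∧ |cov[ξ i, ξ j; P]| ≤ σ)) (hσ : σ < 1)
    (hv : 0 ≤ v) (hu : ∀ i, v ≤ u i) :
    |P.real {ω | ∀ i, η i ω ≤ u i} - P.real {ω | ∀ i, ξ i ω ≤ u i}| ≤
      (∑ i, ∑ j ∈ Finset.univ.erase i, |cov[ξ i, ξ j; P] - cov[η i, η j; P]| *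
        (1 / (2 * Real.pi * √(1 - σ ^ 2)) * Real.exp (-v ^ 2 / (1 + |cov[ξ i, ξ j; P]|)))) *
      (Real.pi / 2) := by
  have := hg.isProbabilityMeasure
  choose φ φ' hd hc hC h0 h1 hone hzero hs hI using
    fun (m : ℕ) (i : ι) => exists_smooth_cutoff (u i) (Nat.one_div_pos_of_nat (α := ℝ) (n := m))
  have hφc (m : ℕ) (i : ι) : Continuous (φ m i) :=
    continuous_iff_continuousAt.2 fun x => (hd m i x).continuousAt
  refine le_of_tendsto ((tendsto_integral_prod_cutoff hφc h0 h1 hone hzero hηm).sub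
    (tendsto_integral_prod_cutoff hφc h0 h1 hone hzero hξm)).abs (Eventually.of_forall fun m => ?_)
  choose C hC using hC m
  refine abs_integral_prod_sub_le (C := ∑ i, |C i|) hg hξ0 hη0 hξ1 hη1 hξη hcov hσ (hd m) (hc m)
    (fun i x => (hC i x).trans ((le_abs_self _).trans
      (Finset.single_le_sum (f := fun i => |C i|) (fun i _ => abs_nonneg _) (Finset.mem_univ i))))
    (h0 m) (h1 m) hv (fun i x hx => hs m i x (hx.trans_le (hu i))) (hI m)

end Comparison

/-! ### Asymptotics of the thresholds -/

/-- The correction `ln (4 π ln n)` in the threshold. -/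
def logCorr (n : ℕ) : ℝ := Real.log (4 * Real.pi * Real.log n)

lemma tendsto_log_natCast : Tendsto (fun n : ℕ => Real.log n) atTop atTop :=
  Real.tendsto_log_atTop.comp tendsto_natCast_atTop_atTop

lemma tendsto_logCorr_pow_div (k : ℕ) :
    Tendsto (fun n : ℕ => logCorr n ^ k / Real.log n) atTop (𝓝 0) := by
  have h1 : Tendsto (fun x : ℝ => Real.log x ^ k / x) atTop (𝓝 0) :=
    (Real.isLittleO_pow_log_id_atTop (n := k)).tendsto_div_nhds_zero
  have h2 : Tendsto (fun n : ℕ => 4 * Real.pi * Real.log n) atTop atTop :=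
    tendsto_log_natCast.const_mul_atTop (by positivity)
  have h3 := (h1.comp h2).const_mul (4 * Real.pi)
  rw [mul_zero] at h3
  refine h3.congr fun n => ?_
  have := Real.pi_pos
  simp only [Function.comp, logCorr]
  field_simp

lemma tendsto_logCorr_div : Tendsto (fun n : ℕ => logCorr n / Real.log n) atTop (𝓝 0) := by
  simpa using tendsto_logCorr_pow_div 1

lemma tendsto_sub_logCorr_sq_div (s : ℝ) :
    Tendsto (fun n : ℕ => (s - logCorr n / 2) ^ 2 / Real.log n) atTop (𝓝 0) := by
  have h0 : Tendsto (fun n : ℕ => s ^ 2 / Real.log n) atTop (𝓝 0) :=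
    tendsto_const_nhds.div_atTop tendsto_log_natCast
  have := (h0.sub (tendsto_logCorr_div.const_mul s)).add ((tendsto_logCorr_pow_div 2).div_const 4)
  simp only [mul_zero, sub_zero, zero_div, add_zero] at this
  refine this.congr fun n => ?_
  ring

lemma log_natCast_pos {n : ℕ} (hn : 2 ≤ n) : 0 < Real.log n :=
  Real.log_pos (by exact_mod_cast hn)

lemma u_mul_sqrt {n : ℕ} (hn : 2 ≤ n) (s : ℝ) :
    u n s * √(2 * Real.log n) = 2 * Real.log n + (s - logCorr n / 2) := by
  have hL := log_natCast_pos hn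
  have hw : 0 < √(2 * Real.log n) := Real.sqrt_pos.2 (by positivity)
  have hw2 : √(2 * Real.log n) * √(2 * Real.log n) = 2 * Real.log n :=
    Real.mul_self_sqrt (by positivity)
  simp only [u, a, b, logCorr]
  calc _ = √(2 * Real.log n) * √(2 * Real.log n) +
        (s - Real.log (4 * Real.pi * Real.log n) / 2) := by field_simp; ring
    _ = _ := by rw [hw2]

lemma u_sq {n : ℕ} (hn : 2 ≤ n) (s : ℝ) :
    u n s ^ 2 = 2 * Real.log n + 2 * s - logCorr n + (s - logCorr n / 2) ^ 2 / (2 * Real.log n) := by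
  have hL := log_natCast_pos hn
  have hw2 : √(2 * Real.log n) ^ 2 = 2 * Real.log n := Real.sq_sqrt (by positivity)
  have h : u n s ^ 2 * (2 * Real.log n) = (2 * Real.log n + (s - logCorr n / 2)) ^ 2 := by
    rw [← u_mul_sqrt hn, mul_pow, hw2]
  rw [← mul_left_inj' (by positivity : 2 * Real.log n ≠ 0), h]
  field_simp
  ring

/-- The dropped square is nonnegative, so the elementary main terms alone bound `exp(-u²/(1 + c))`
from above. -/
lemma le_u_sq {n : ℕ} (hn : 2 ≤ n) (s : ℝ) : 2 * Real.log n + 2 * s - logCorr n ≤ u n s ^ 2 := by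
  have hL := log_natCast_pos hn
  rw [u_sq hn]
  have : 0 ≤ (s - logCorr n / 2) ^ 2 / (2 * Real.log n) := by positivity
  linarith

lemma eventually_u_pos (s : ℝ) : ∀ᶠ n in atTop, 0 < u n s := by
  have h0 : Tendsto (fun n : ℕ => s / Real.log n) atTop (𝓝 0) :=
    tendsto_const_nhds.div_atTop tendsto_log_natCast
  have h : Tendsto (fun n : ℕ => 2 + (s / Real.log n - logCorr n / Real.log n / 2)) atTop
      (𝓝 (2 + (0 - 0 / 2))) := (h0.sub (tendsto_logCorr_div.div_const 2)).const_add 2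
  filter_upwards [h.eventually_const_lt (by norm_num : (0 : ℝ) < 2 + (0 - 0 / 2)),
    eventually_ge_atTop 2] with n h1 hn
  have hL := log_natCast_pos hn
  have hw : 0 < √(2 * Real.log n) := Real.sqrt_pos.2 (by positivity)
  refine pos_of_mul_pos_left (b := √(2 * Real.log n)) ?_ hw.le
  rw [u_mul_sqrt hn]
  have := mul_pos h1 hL
  have e : (2 + (s / Real.log n - logCorr n / Real.log n / 2)) * Real.log n =
    2 * Real.log n + (s - logCorr n / 2) := by field_simp
  rwa [e] at this

lemma u_mono (n : ℕ) : Monotone (u n) := fun s t h => by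
  simp only [u, a]
  gcongr

/-- This is the contribution of the near lags. Its exponent is `ln n` times a quantity tending to `1
+ α - 2/(1+σ)`, which is negative because `(1-σ)/(1+σ) = 2/(1+σ) - 1`. -/
lemma tendsto_mul_rpow_mul_exp {σ α : ℝ} (s : ℝ) (hσ : 0 ≤ σ) (hα : α < (1 - σ) / (1 + σ)) :
    Tendsto (fun n : ℕ => (n : ℝ) * (n : ℝ) ^ α * Real.exp (-u n s ^ 2 / (1 + σ))) atTop (𝓝 0) := by
  have hσ1 : 0 < 1 + σ := by linarith
  set κ := 2 / (1 + σ) - 1 - α with hκ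
  have hκ0 : 0 < κ := by
    have : (1 - σ) / (1 + σ) = 2 / (1 + σ) - 1 := by field_simp; ring
    rw [hκ]; linarith
  have h0 : Tendsto (fun n : ℕ => 2 * s / Real.log n) atTop (𝓝 0) :=
    tendsto_const_nhds.div_atTop tendsto_log_natCast
  have h1 : Tendsto (fun n : ℕ => Real.log n *
      (-κ + (logCorr n / Real.log n - 2 * s / Real.log n) / (1 + σ))) atTop atBot := by
    refine tendsto_log_natCast.atTop_mul_neg (C := -κ + (0 - 0) / (1 + σ)) (by simpa using hκ0) ?_
    exact ((tendsto_logCorr_div.sub h0).div_const _).const_add _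
  refine squeeze_zero' (Eventually.of_forall fun n => by positivity) ?_
    (Real.tendsto_exp_atBot.comp h1)
  filter_upwards [eventually_ge_atTop 2] with n hn
  have hL := log_natCast_pos hn
  have hn0 : (0 : ℝ) < n := by positivity
  have e2 : (n : ℝ) * (n : ℝ) ^ α * Real.exp (-u n s ^ 2 / (1 + σ)) =
      Real.exp (Real.log n + Real.log n * α + -u n s ^ 2 / (1 + σ)) := by
    rw [Real.exp_add, Real.exp_add, Real.exp_log hn0, Real.rpow_def_of_pos hn0]
  rw [e2]
  refine Real.exp_le_exp.2 ?_
  have h2 : -u n s ^ 2 / (1 + σ) ≤ -(2 * Real.log n + 2 * s - logCorr n) / (1 + σ) := by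
    have := le_u_sq hn s
    gcongr
  have e3 : Real.log n * (-κ + (logCorr n / Real.log n - 2 * s / Real.log n) / (1 + σ)) =
      Real.log n + Real.log n * α + -(2 * Real.log n + 2 * s - logCorr n) / (1 + σ) := by
    rw [hκ]; field_simp; ring
  beta_reduce
  rw [e3]
  linarith

/-- This is the contribution of the far lags. The factor `n²` cancels `exp(-u²) ≈ n⁻² · 4π ln n ·
exp(-2s)`, leaving `δ ln n`; replacing `u²` by `u²/(1+δ)` costs only a bounded factor `exp(O(δ ln
n))`. -/
lemma tendsto_sq_mul_mul_exp {δ : ℕ → ℝ} (s : ℝ) (hδ0 : ∀ n, 0 ≤ δ n)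
    (hδ : Tendsto (fun n : ℕ => δ n * Real.log n) atTop (𝓝 0)) :
    Tendsto (fun n : ℕ => (n : ℝ) ^ 2 * (δ n * Real.exp (-u n s ^ 2 / (1 + δ n)))) atTop (𝓝 0) := by
  have h0 : Tendsto (fun n : ℕ => 2 * s / Real.log n) atTop (𝓝 0) :=
    tendsto_const_nhds.div_atTop tendsto_log_natCast
  have hm : Tendsto (fun n : ℕ => 2 + (2 * s / Real.log n - logCorr n / Real.log n)) atTop
      (𝓝 (2 + (0 - 0))) := (h0.sub tendsto_logCorr_div).const_add 2
  have h1 : Tendsto (fun n : ℕ => (δ n * Real.log n) * (4 * Real.pi * Real.exp (-(2 * s))) *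
      Real.exp ((δ n * Real.log n) * (2 + (2 * s / Real.log n - logCorr n / Real.log n)))) atTop
      (𝓝 0) := by
    have := (hδ.mul_const (4 * Real.pi * Real.exp (-(2 * s)))).mul
      ((Real.continuous_exp.tendsto _).comp (hδ.mul hm))
    simpa using this
  refine squeeze_zero' (Eventually.of_forall fun n => by have := hδ0 n; positivity) ?_ h1
  filter_upwards [eventually_ge_atTop 2,
    hm.eventually_const_lt (by norm_num : (0 : ℝ) < 2 + (0 - 0))] with n hn hmn
  have hL := log_natCast_pos hn
  have hn0 : (0 : ℝ) < n := by positivity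
  have hd := hδ0 n
  set m := 2 * Real.log n + 2 * s - logCorr n with hmdef
  have em : 2 + (2 * s / Real.log n - logCorr n / Real.log n) = m / Real.log n := by
    rw [hmdef]; field_simp; ring
  rw [em] at hmn ⊢
  have hm0 : 0 < m := by
    have := mul_pos hmn hL
    rwa [div_mul_cancel₀ _ hL.ne'] at this
  have e1 : δ n * Real.log n * (m / Real.log n) = δ n * m := by field_simp
  rw [e1]
  -- Uses `1/(1+δ) ≥ 1 - δ`, which needs `m ≥ 0`.
  have h2 : -u n s ^ 2 / (1 + δ n) ≤ -m + δ n * m := by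
    calc -u n s ^ 2 / (1 + δ n) ≤ -m / (1 + δ n) := by
          have := le_u_sq hn s
          gcongr
      _ ≤ -m + δ n * m := by
          rw [div_le_iff₀ (by positivity)]
          nlinarith [mul_nonneg (mul_nonneg hd hd) hm0.le]
  have e2 : Real.exp (-m) = (n : ℝ)⁻¹ ^ 2 * Real.exp (-(2 * s)) * (4 * Real.pi * Real.log n) := by
    have h3 : Real.exp (logCorr n) = 4 * Real.pi * Real.log n := Real.exp_log (by positivity)
    have h4 : Real.exp (-(Real.log n)) = (n : ℝ)⁻¹ := by rw [Real.exp_neg, Real.exp_log hn0]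
    rw [show -m = -(Real.log n) + -(Real.log n) + -(2 * s) + logCorr n by rw [hmdef]; ring,
      Real.exp_add, Real.exp_add, Real.exp_add, h3, h4]
    ring
  calc (n : ℝ) ^ 2 * (δ n * Real.exp (-u n s ^ 2 / (1 + δ n)))
      ≤ (n : ℝ) ^ 2 * (δ n * Real.exp (-m + δ n * m)) := by gcongr
    _ = δ n * Real.log n * (4 * Real.pi * Real.exp (-(2 * s))) * Real.exp (δ n * m) := by
        rw [Real.exp_add, e2]
        field_simp

/-- The rescaled Gaussian density at the threshold. -/
lemma mul_a_mul_gaussianPDFReal_u {n : ℕ} (hn : 2 ≤ n) (t : ℝ) :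
    n * (a n * gaussianPDFReal 0 1 (u n t)) =
      Real.exp (-t) * Real.exp (-((t - logCorr n / 2) ^ 2 / Real.log n / 4)) := by
  have hL := log_natCast_pos hn
  have hn0 : (0 : ℝ) < n := by positivity
  have hpi := Real.pi_pos
  have hw : 0 < √(2 * Real.log n) := Real.sqrt_pos.2 (by positivity)
  have e1 : Real.exp (logCorr n / 2) = √(2 * Real.pi) * √(2 * Real.log n) := by
    rw [← Real.sqrt_mul (by positivity), Real.exp_half, logCorr, Real.exp_log (by positivity)]
    congr 1; ring
  have e2 : -u n t ^ 2 / 2 = -Real.log n + -t + logCorr n / 2 +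
      -((t - logCorr n / 2) ^ 2 / Real.log n / 4) := by
    rw [u_sq hn]; field_simp; ring
  simp only [gaussianPDFReal, a, NNReal.coe_one, mul_one, sub_zero]
  rw [e2, Real.exp_add, Real.exp_add, Real.exp_add, e1, Real.exp_neg (Real.log n),
    Real.exp_log hn0]
  field_simp

lemma tendsto_mul_a_mul_gaussianPDFReal_u (t : ℝ) :
    Tendsto (fun n : ℕ => n * (a n * gaussianPDFReal 0 1 (u n t))) atTop (𝓝 (Real.exp (-t))) := by
  have h := ((tendsto_sub_logCorr_sq_div t).div_const 4).neg
  have := ((Real.continuous_exp.tendsto _).comp h).const_mul (Real.exp (-t))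
  simp only [zero_div, neg_zero, Real.exp_zero, mul_one] at this
  refine this.congr' ?_
  filter_upwards [eventually_ge_atTop 2] with n hn
  exact (mul_a_mul_gaussianPDFReal_u hn t).symm

/-- Supplies the dominating function, integrable on every right half-line, for the passage to the
limit in `tailProb`. -/
lemma mul_a_mul_gaussianPDFReal_u_le {n : ℕ} (hn : 2 ≤ n) (t : ℝ) :
    n * (a n * gaussianPDFReal 0 1 (u n t)) ≤ Real.exp (-t) := by
  have hL := log_natCast_pos hn
  rw [mul_a_mul_gaussianPDFReal_u hn]
  refine mul_le_of_le_one_right (Real.exp_pos _).le (Real.exp_le_one_iff.2 ?_)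
  rw [neg_nonpos]
  positivity

/-! ### Tails of a bivariate Gaussian vector -/

/-- The conditional probability that the first component is at most `u n x`, given that the second
component equals `u n t`, for a standard bivariate Gaussian vector with correlation `r`. -/
def condProb (n : ℕ) (r x t : ℝ) : ℝ :=
  (gaussianReal 0 1).real {z | √(1 - r ^ 2) * z ≤ u n x - r * u n t}

/-- The probability that a standard bivariate Gaussian vector with correlation `r` exceeds
`(u n x, u n y)` in some component, as an integral in the rescaled variable. -/
def tailProb (n : ℕ) (r x y : ℝ) : ℝ :=
  (∫ t in Set.Ioi x, a n * gaussianPDFReal 0 1 (u n t)) +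
    ∫ t in Set.Ioi y, a n * gaussianPDFReal 0 1 (u n t) * condProb n r x t

lemma a_pos {n : ℕ} (hn : 2 ≤ n) : 0 < a n := by
  have := log_natCast_pos hn
  rw [a]
  positivity

lemma integral_indicator_Ioi_u {n : ℕ} (hn : 2 ≤ n) (y : ℝ) (g : ℝ → ℝ) :
    ∫ s, (Set.Ioi (u n y)).indicator g s ∂gaussianReal 0 1 =
      ∫ t in Set.Ioi y, a n * gaussianPDFReal 0 1 (u n t) * g (u n t) := by
  have ha := a_pos hn
  rw [integral_gaussianReal_eq_integral_smul one_ne_zero, ← integral_indicator measurableSet_Ioi,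
    ← integral_add_right_eq_self _ (b n)]
  have h := Measure.integral_comp_mul_left (fun s => gaussianPDFReal 0 1 (s + b n) •
    (Set.Ioi (u n y)).indicator g (s + b n)) (a n)
  rw [abs_of_pos (inv_pos.2 ha), smul_eq_mul] at h
  rw [← mul_inv_cancel_left₀ ha.ne' (∫ x, _), ← h, ← integral_const_mul]
  congr with t
  have hlt : u n y < a n * t + b n ↔ y < t := by
    rw [u, add_lt_add_iff_right]
    exact mul_lt_mul_iff_right₀ ha
  by_cases ht : y < t
  · rw [Set.indicator_of_mem (Set.mem_Ioi.2 (hlt.2 ht)), Set.indicator_of_mem (Set.mem_Ioi.2 ht),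
      smul_eq_mul, mul_assoc]
    rfl
  · rw [Set.indicator_of_notMem (mt Set.mem_Ioi.1 (mt hlt.1 ht)),
      Set.indicator_of_notMem (mt Set.mem_Ioi.1 ht)]
    simp

lemma gaussianReal_eq_map_mul (v : ℝ) (hv : 0 ≤ v) :
    gaussianReal 0 v.toNNReal = (gaussianReal 0 1).map (fun z => √v * z) := by
  rw [gaussianReal_map_const_mul, mul_zero, mul_one]
  congr 1
  ext
  simp [Real.coe_toNNReal _ hv, Real.sq_sqrt hv]

lemma measurable_condProb (n : ℕ) (r x : ℝ) : Measurable (condProb n r x) := by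
  have hs : MeasurableSet {p : ℝ × ℝ | √(1 - r ^ 2) * p.2 ≤ u n x - r * u n p.1} := by
    simp only [u]
    exact measurableSet_le (by fun_prop) (by fun_prop)
  exact (measurable_measure_prodMk_left (ν := gaussianReal 0 1) hs).ennreal_toReal

lemma condProb_nonneg (n : ℕ) (r x t : ℝ) : 0 ≤ condProb n r x t := measureReal_nonneg

lemma condProb_le_one (n : ℕ) (r x t : ℝ) : condProb n r x t ≤ 1 := measureReal_le_one

variable {Ω : Type*} [MeasurableSpace Ω] {P : Measure Ω}

lemma covariance_sq_le_one {A B : Ω → ℝ} {r : ℝ} [IsProbabilityMeasure P]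
    (hA : MemLp A 2 P) (hB : MemLp B 2 P) (hvA : Var[A; P] = 1) (hvB : Var[B; P] = 1)
    (hr : cov[A, B; P] = r) : r ^ 2 ≤ 1 := by
  have h : Var[fun ω => B ω - r * A ω; P] = 1 - r ^ 2 := by
    have hm : AEMeasurable (fun ω => B ω - r * A ω) P :=
      hB.aemeasurable.sub (hA.aemeasurable.const_mul r)
    rw [← covariance_self hm,
      covariance_fun_sub_fun_sub hB (hA.const_mul _) hB (hA.const_mul _),
      covariance_const_mul_right, covariance_const_mul_left, covariance_const_mul_left,
      covariance_const_mul_right, covariance_self hA.aemeasurable,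
      covariance_self hB.aemeasurable, hvA, hvB, covariance_comm B A, hr]
    ring
  have := variance_nonneg (fun ω => B ω - r * A ω) P
  linarith

/-- Disintegrate along `A`: given `A = s`, the variable `B` is `r * s` plus independent noise of
variance `1 - r²`. Writing the noise as `√(1 - r²) * z` also covers `r² = 1`. -/
lemma measureReal_lt_and_le {A B : Ω → ℝ} {r : ℝ} {n : ℕ} (hn : 2 ≤ n)
    (hAB : HasGaussianLaw (fun ω => (A ω, B ω)) P)
    (hA : ∫ ω, A ω ∂P = 0) (hB : ∫ ω, B ω ∂P = 0) (hvA : Var[A; P] = 1) (hvB : Var[B; P] = 1)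
    (hr : cov[A, B; P] = r) (x y : ℝ) :
    P.real {ω | u n y < A ω ∧ B ω ≤ u n x} =
      ∫ t in Set.Ioi y, a n * gaussianPDFReal 0 1 (u n t) * condProb n r x t := by
  have := hAB.isProbabilityMeasure
  have hr2 : 0 ≤ 1 - r ^ 2 := by
    have := covariance_sq_le_one hAB.fst.memLp_two hAB.snd.memLp_two hvA hvB hr
    linarith
  have hmeas : AEMeasurable (fun ω => (A ω, B ω - r * A ω)) P := by
    have h2 := hAB.fst.aemeasurable
    have h3 := hAB.snd.aemeasurable
    fun_prop
  have hs : MeasurableSet {p : ℝ × ℝ | u n y < p.1 ∧ p.2 + r * p.1 ≤ u n x} := by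
    rw [Set.ofPred_and]
    exact (measurableSet_lt (by fun_prop) (by fun_prop)).inter
      (measurableSet_le (by fun_prop) (by fun_prop))
  have e1 : P.real {ω | u n y < A ω ∧ B ω ≤ u n x} =
      (P.map (fun ω => (A ω, B ω - r * A ω))).real
        {p : ℝ × ℝ | u n y < p.1 ∧ p.2 + r * p.1 ≤ u n x} := by
    rw [measureReal_def, measureReal_def, Measure.map_apply_of_aemeasurable hmeas hs]
    congr 2
    ext ω
    simp
  rw [e1, map_prodMk_sub_mul hAB hA hB hvA hvB hr, measureReal_def, Measure.prod_apply hs,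
    ← integral_toReal (measurable_measure_prodMk_left hs).aemeasurable
      (ae_of_all _ fun s => measure_lt_top _ _)]
  have e2 : (fun s => (gaussianReal 0 (1 - r ^ 2).toNNReal (Prod.mk s ⁻¹'
      {p : ℝ × ℝ | u n y < p.1 ∧ p.2 + r * p.1 ≤ u n x})).toReal) =
      (Set.Ioi (u n y)).indicator
        (fun s => (gaussianReal 0 1).real {z | √(1 - r ^ 2) * z ≤ u n x - r * s}) := by
    ext s
    by_cases hsy : u n y < s
    · rw [Set.indicator_of_mem (Set.mem_Ioi.2 hsy), gaussianReal_eq_map_mul _ hr2, measureReal_def,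
        Measure.map_apply (by fun_prop)]
      · congr 2
        ext z
        simp [hsy, le_sub_iff_add_le]
      · exact measurable_prodMk_left hs
    · rw [Set.indicator_of_notMem (mt Set.mem_Ioi.1 hsy)]
      simp [hsy]
  rw [e2, integral_indicator_Ioi_u hn]
  rfl

lemma measureReal_lt {B : Ω → ℝ} {n : ℕ} (hn : 2 ≤ n) (hBg : HasGaussianLaw B P)
    (hB : ∫ ω, B ω ∂P = 0) (hvB : Var[B; P] = 1) (x : ℝ) :
    P.real {ω | u n x < B ω} = ∫ t in Set.Ioi x, a n * gaussianPDFReal 0 1 (u n t) := by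
  have h := integral_indicator_Ioi_u hn x (fun _ => 1)
  simp only [mul_one] at h
  rw [← h]
  have h1 : P.map B = gaussianReal 0 1 := by rw [hBg.map_eq_gaussianReal, hB, hvB]; simp
  have h2 := integral_indicator_one (μ := gaussianReal 0 1) (s := Set.Ioi (u n x)) measurableSet_Ioi
  rw [show (fun s => (Set.Ioi (u n x)).indicator (fun _ => (1 : ℝ)) s) =
    (Set.Ioi (u n x)).indicator 1 from rfl, h2, ← h1, measureReal_def, measureReal_def,
    Measure.map_apply_of_aemeasurable hBg.aemeasurable measurableSet_Ioi]
  rfl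

/-- The joint distribution function of a standard bivariate Gaussian vector at the thresholds. -/
lemma measureReal_le_and_le {A B : Ω → ℝ} {r : ℝ} {n : ℕ} (hn : 2 ≤ n)
    (hAB : HasGaussianLaw (fun ω => (A ω, B ω)) P)
    (hA : ∫ ω, A ω ∂P = 0) (hB : ∫ ω, B ω ∂P = 0) (hvA : Var[A; P] = 1) (hvB : Var[B; P] = 1)
    (hr : cov[A, B; P] = r) (x y : ℝ) :
    P.real {ω | B ω ≤ u n x ∧ A ω ≤ u n y} = 1 - tailProb n r x y := by
  have := hAB.isProbabilityMeasure
  rw [tailProb, ← measureReal_lt hn hAB.snd hB hvB x,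
    ← measureReal_lt_and_le hn hAB hA hB hvA hvB hr x y]
  have hAm := hAB.fst.aemeasurable
  have hBm := hAB.snd.aemeasurable
  have n1 : NullMeasurableSet {ω | B ω ≤ u n x} P := nullMeasurableSet_le hBm aemeasurable_const
  have n2 : NullMeasurableSet {ω | A ω ≤ u n y} P := nullMeasurableSet_le hAm aemeasurable_const
  have h1 : P.real {ω | u n x < B ω} = 1 - P.real {ω | B ω ≤ u n x} := by
    have e : {ω | u n x < B ω} = {ω | B ω ≤ u n x}ᶜ := by ext; simp
    rw [e, probReal_compl_eq_one_sub₀ n1]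
  have h2 : P.real {ω | B ω ≤ u n x} = P.real {ω | B ω ≤ u n x ∧ A ω ≤ u n y} +
      P.real {ω | u n y < A ω ∧ B ω ≤ u n x} := by
    rw [← measureReal_inter_add_sdiff₀ n2 (s := {ω | B ω ≤ u n x})]
    congr 2
    ext ω
    simp [and_comm]
  linarith

/-! ### Limits of conditional probabilities -/

/-- The half-line is kept as `s * z ≤ d` without dividing by `s`, so that `s₀ = 0`, which is the
case `λ = 0`, is included. The excluded case `s₀ = d₀ = 0` is the only one in which the boundary has
positive mass. -/
lemma tendsto_gaussianReal_halfline {s d : ℕ → ℝ} {s₀ d₀ : ℝ}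
    (hs : Tendsto s atTop (𝓝 s₀)) (hd : Tendsto d atTop (𝓝 d₀)) (h : s₀ ≠ 0 ∨ d₀ ≠ 0) :
    Tendsto (fun n => (gaussianReal 0 1).real {z | s n * z ≤ d n}) atTop
      (𝓝 ((gaussianReal 0 1).real {z | s₀ * z ≤ d₀})) := by
  have hms (s d : ℝ) : MeasurableSet {z : ℝ | s * z ≤ d} :=
    measurableSet_le (by fun_prop) (by fun_prop)
  have hae : ∀ᵐ z ∂(gaussianReal 0 1), s₀ * z ≠ d₀ := by
    rcases eq_or_ne s₀ 0 with h0 | h0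
    · refine ae_of_all _ fun z => ?_
      rcases h with h | h
      · exact absurd h0 h
      · simpa [h0] using h.symm
    · have := nullSingletonClass_gaussianReal (μ := 0) (v := 1) one_ne_zero
      have h1 : ∀ᵐ z ∂(gaussianReal 0 1), z ≠ d₀ / s₀ := by
        simp [ae_iff]
      filter_upwards [h1] with z hz h2
      exact hz (by rw [← h2]; field_simp)
  simp_rw [← integral_indicator_one (hms _ _)]
  refine tendsto_integral_of_dominated_convergence (fun _ => 1)
    (fun n => ((measurable_one.indicator (hms _ _))).aestronglyMeasurable) (integrable_const 1)
    (fun n => ae_of_all _ fun z => ?_) ?_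
  · refine (norm_indicator_le_norm_self _ _).trans ?_
    simp
  · filter_upwards [hae] with z hz
    have hlim : Tendsto (fun n => d n - s n * z) atTop (𝓝 (d₀ - s₀ * z)) := hd.sub (hs.mul_const z)
    refine tendsto_const_nhds.congr' ?_
    rcases lt_or_gt_of_ne hz with hz | hz
    · filter_upwards [hlim.eventually_const_lt (sub_pos.2 hz)] with n hn
      have h1 : z ∈ {z : ℝ | s₀ * z ≤ d₀} := by simpa using hz.le
      have h2 : z ∈ {z : ℝ | s n * z ≤ d n} := by simpa using (sub_pos.1 hn).le
      rw [Set.indicator_of_mem h1, Set.indicator_of_mem h2]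
    · filter_upwards [hlim.eventually_lt_const (sub_neg.2 hz)] with n hn
      have h1 : z ∉ {z : ℝ | s₀ * z ≤ d₀} := by simpa using hz
      have h2 : z ∉ {z : ℝ | s n * z ≤ d n} := by simpa using (sub_neg.1 hn)
      rw [Set.indicator_of_notMem h1, Set.indicator_of_notMem h2]

lemma tendsto_gaussianReal_one {S : ℕ → Set ℝ} (hS : ∀ n, MeasurableSet (S n))
    (h : ∀ z, ∀ᶠ n in atTop, z ∈ S n) :
    Tendsto (fun n => (gaussianReal 0 1).real (S n)) atTop (𝓝 1) := by
  simp_rw [← integral_indicator_one (hS _)]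
  have h1 : (1 : ℝ) = ∫ _, (1 : ℝ) ∂(gaussianReal 0 1) := by simp
  rw [h1]
  refine tendsto_integral_of_dominated_convergence (fun _ => 1)
    (fun n => ((measurable_one.indicator (hS _))).aestronglyMeasurable) (integrable_const 1)
    (fun n => ae_of_all _ fun z => ?_) (ae_of_all _ fun z => ?_)
  · refine (norm_indicator_le_norm_self _ _).trans ?_
    simp
  · refine tendsto_const_nhds.congr' ?_
    filter_upwards [h z] with n hn
    rw [Set.indicator_of_mem hn]
    rfl

/-- Multiplying the inequality by `√(2 ln n)` expresses both sides through `(1 - r) ln n`, the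
quantity whose limit is prescribed. -/
lemma condProb_eq {n : ℕ} (hn : 2 ≤ n) (r x t : ℝ) :
    condProb n r x t = (gaussianReal 0 1).real
      {z | √((1 - r) * Real.log n * (2 * (1 + r))) * z ≤
        (1 - r) * Real.log n * (2 - logCorr n / Real.log n / 2) + (x - r * t)} := by
  have hL := log_natCast_pos hn
  have hw : 0 < √(2 * Real.log n) := Real.sqrt_pos.2 (by positivity)
  rw [condProb]
  congr 1
  ext z
  have e1 : √((1 - r) * Real.log n * (2 * (1 + r))) = √(2 * Real.log n) * √(1 - r ^ 2) := by
    rw [← Real.sqrt_mul (by positivity)]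
    congr 1; ring
  have e2 : (1 - r) * Real.log n * (2 - logCorr n / Real.log n / 2) + (x - r * t) =
      √(2 * Real.log n) * (u n x - r * u n t) := by
    have h1 := u_mul_sqrt hn x
    have h2 := u_mul_sqrt hn t
    have h3 : √(2 * Real.log n) * (u n x - r * u n t) =
      u n x * √(2 * Real.log n) - r * (u n t * √(2 * Real.log n)) := by ring
    rw [h3, h1, h2]
    field_simp
    ring
  simp only [Set.mem_ofPred_eq]
  rw [e1, e2, mul_assoc]
  exact (mul_le_mul_iff_right₀ hw).symm

lemma tendsto_condProb {r : ℕ → ℝ} {l : ℝ} (hl : 0 ≤ l)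
    (h : Tendsto (fun n : ℕ => (1 - r n) * Real.log n) atTop (𝓝 (l ^ 2))) {x t : ℝ}
    (hxt : l ≠ 0 ∨ x ≠ t) :
    Tendsto (fun n => condProb n (r n) x t) atTop
      (𝓝 ((gaussianReal 0 1).real {z | 2 * l * z ≤ 2 * l ^ 2 + (x - t)})) := by
  have hr1 : Tendsto r atTop (𝓝 1) := by
    have h1 : Tendsto (fun n : ℕ => 1 - (1 - r n) * Real.log n / Real.log n) atTop (𝓝 (1 - 0)) :=
      (h.div_atTop tendsto_log_natCast).const_sub 1
    rw [sub_zero] at h1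
    refine h1.congr' ?_
    filter_upwards [eventually_ge_atTop 2] with n hn
    have := log_natCast_pos hn
    field_simp
    ring
  have hs : Tendsto (fun n : ℕ => √((1 - r n) * Real.log n * (2 * (1 + r n)))) atTop
      (𝓝 (2 * l)) := by
    have h1 := (Real.continuous_sqrt.tendsto _).comp (h.mul ((hr1.const_add 1).const_mul 2))
    have e : √(l ^ 2 * (2 * (1 + 1))) = 2 * l := by
      rw [show l ^ 2 * (2 * (1 + 1)) = (2 * l) ^ 2 by ring, Real.sqrt_sq (by positivity)]
    rwa [e] at h1
  have hd : Tendsto (fun n : ℕ => (1 - r n) * Real.log n * (2 - logCorr n / Real.log n / 2) +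
      (x - r n * t)) atTop (𝓝 (2 * l ^ 2 + (x - t))) := by
    have h1 := (h.mul ((tendsto_logCorr_div.div_const 2).const_sub 2)).add
      ((hr1.mul_const t).const_sub x)
    have e : l ^ 2 * (2 - 0 / 2) + (x - 1 * t) = 2 * l ^ 2 + (x - t) := by ring
    rwa [e] at h1
  have hne : 2 * l ≠ 0 ∨ 2 * l ^ 2 + (x - t) ≠ 0 := by
    rcases eq_or_ne l 0 with h0 | h0
    · right
      simpa [h0, sub_eq_zero] using hxt
    · left; simpa using h0
  refine (tendsto_gaussianReal_halfline hs hd hne).congr' ?_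
  filter_upwards [eventually_ge_atTop 2] with n hn
  exact (condProb_eq hn (r n) x t).symm

lemma tendsto_condProb_one {r : ℕ → ℝ} (hr : ∀ n, 2 ≤ n → r n ^ 2 ≤ 1)
    (h : Tendsto (fun n : ℕ => (1 - r n) * Real.log n) atTop atTop) (x t : ℝ) :
    Tendsto (fun n => condProb n (r n) x t) atTop (𝓝 1) := by
  have key := tendsto_gaussianReal_one
    (S := fun n : ℕ => {z | √((1 - r n) * Real.log n * (2 * (1 + r n))) * z ≤
        (1 - r n) * Real.log n * (2 - logCorr n / Real.log n / 2) + (x - r n * t)})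
    (fun n => measurableSet_le (by fun_prop) (by fun_prop)) fun z => ?_
  · refine key.congr' ?_
    filter_upwards [eventually_ge_atTop 2] with n hn
    exact (condProb_eq hn (r n) x t).symm
  have h2 := tendsto_logCorr_div.eventually_lt_const (by norm_num : (0 : ℝ) < 2)
  -- With `q = (1 - r) ln n`, the right side is at least `q - |x| - |t|` and the left at most `2√q
  -- |z|`. The bounds `√q ≥ 2|z| + |x| + |t|` and `√q ≥ 1` give the inequality. No limit of `r` is
  -- needed.
  filter_upwards [eventually_ge_atTop 2, h2,
    h.eventually_ge_atTop ((2 * |z| + |x| + |t|) ^ 2), h.eventually_ge_atTop 1] with n hn h3 h4 h5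
  have hrn : |r n| ≤ 1 := (sq_le_one_iff_abs_le_one _).1 (hr n hn)
  have hrb := abs_le.1 hrn
  set q := (1 - r n) * Real.log n with hq
  have hq0 : 0 < q := by linarith
  have hsq : √q * √q = q := Real.mul_self_sqrt hq0.le
  have hs1 : 1 ≤ √q := Real.one_le_sqrt.2 h5
  have hs2 : 2 * |z| + |x| + |t| ≤ √q := Real.le_sqrt_of_sq_le h4
  have h6 : √(q * (2 * (1 + r n))) ≤ 2 * √q := by
    rw [show 2 * √q = √(q * 4) by
      rw [Real.sqrt_mul hq0.le, show (4 : ℝ) = 2 ^ 2 by norm_num,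
        Real.sqrt_sq (by norm_num : (0 : ℝ) ≤ 2)]; ring]
    refine Real.sqrt_le_sqrt ?_
    have : 2 * (1 + r n) ≤ 4 := by linarith
    gcongr
  have h7 : √(q * (2 * (1 + r n))) * z ≤ 2 * √q * |z| :=
    (mul_le_mul_of_nonneg_left (le_abs_self z) (Real.sqrt_nonneg _)).trans
      (mul_le_mul_of_nonneg_right h6 (abs_nonneg z))
  have h8 : q * 1 ≤ q * (2 - logCorr n / Real.log n / 2) := by
    gcongr
    linarith
  have h9 : -(|x| + |t|) ≤ x - r n * t := by
    have h10 : |r n * t| ≤ |t| := by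
      rw [abs_mul]
      exact mul_le_of_le_one_left (abs_nonneg _) hrn
    linarith [neg_abs_le x, le_abs_self (r n * t)]
  nlinarith [abs_nonneg x, abs_nonneg t, mul_le_mul_of_nonneg_left hs2 (by positivity : 0 ≤ √q),
    mul_le_mul_of_nonneg_right hs1 (add_nonneg (abs_nonneg x) (abs_nonneg t))]

/-- Convergence of the rescaled tail probability, given that of the conditional probabilities. -/
lemma tendsto_mul_tailProb {r : ℕ → ℝ} {x y : ℝ} {G : ℝ → ℝ}
    (hG : ∀ᵐ t, Tendsto (fun n => condProb n (r n) x t) atTop (𝓝 (G t))) :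
    Tendsto (fun n : ℕ => n * tailProb n (r n) x y) atTop
      (𝓝 (Real.exp (-x) + ∫ t in Set.Ioi y, Real.exp (-t) * G t)) := by
  have hpm (n : ℕ) : Measurable fun t => (n : ℝ) * (a n * gaussianPDFReal 0 1 (u n t)) := by
    have := measurable_gaussianPDFReal 0 1
    simp only [u]
    fun_prop
  have hp0 (n : ℕ) (t : ℝ) : 0 ≤ (n : ℝ) * (a n * gaussianPDFReal 0 1 (u n t)) := by
    have := gaussianPDFReal_nonneg 0 1 (u n t)
    have : 0 ≤ a n := by rw [a]; positivity
    positivity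
  have h1 : Tendsto (fun n : ℕ => ∫ t in Set.Ioi x, n * (a n * gaussianPDFReal 0 1 (u n t))) atTop
      (𝓝 (∫ t in Set.Ioi x, Real.exp (-t))) := by
    refine tendsto_integral_filter_of_dominated_convergence (fun t => Real.exp (-t))
      (Eventually.of_forall fun n => (hpm n).aestronglyMeasurable) ?_ (integrableOn_exp_neg_Ioi x)
      (ae_of_all _ fun t => tendsto_mul_a_mul_gaussianPDFReal_u t)
    filter_upwards [eventually_ge_atTop 2] with n hn
    refine ae_of_all _ fun t => ?_
    rw [Real.norm_of_nonneg (hp0 n t)]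
    exact mul_a_mul_gaussianPDFReal_u_le hn t
  have h2 : Tendsto (fun n : ℕ => ∫ t in Set.Ioi y, n * (a n * gaussianPDFReal 0 1 (u n t)) *
      condProb n (r n) x t) atTop (𝓝 (∫ t in Set.Ioi y, Real.exp (-t) * G t)) := by
    refine tendsto_integral_filter_of_dominated_convergence (fun t => Real.exp (-t))
      (Eventually.of_forall fun n =>
        ((hpm n).mul (measurable_condProb n (r n) x)).aestronglyMeasurable) ?_
      (integrableOn_exp_neg_Ioi y) (ae_restrict_of_ae ?_)
    · filter_upwards [eventually_ge_atTop 2] with n hn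
      refine ae_of_all _ fun t => ?_
      rw [Real.norm_of_nonneg (mul_nonneg (hp0 n t) (condProb_nonneg _ _ _ _))]
      exact (mul_le_of_le_one_right (hp0 n t) (condProb_le_one _ _ _ _)).trans
        (mul_a_mul_gaussianPDFReal_u_le hn t)
    · filter_upwards [hG] with t ht
      exact (tendsto_mul_a_mul_gaussianPDFReal_u t).mul ht
  rw [integral_exp_neg_Ioi] at h1
  refine (h1.add h2).congr fun n => ?_
  rw [tailProb, mul_add, ← integral_const_mul, ← integral_const_mul]
  simp only [mul_assoc]

/-! ### The exponent measure -/

lemma Phi_eq (x : ℝ) : Phi x = (gaussianReal 0 1).real (Set.Iic x) := cdf_eq_real _ _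

lemma continuous_gaussianPDFReal : Continuous (gaussianPDFReal 0 1) :=
  continuous_iff_continuousAt.2 fun x => (hasDerivAt_gaussianPDFReal_zero 1 x).continuousAt

lemma hasDerivAt_Phi (x : ℝ) : HasDerivAt Phi (gaussianPDFReal 0 1 x) x := by
  have hint := integrable_gaussianPDFReal 0 1
  have h : Phi = fun x => (∫ t in (0 : ℝ)..x, gaussianPDFReal 0 1 t) +
      ∫ t in Set.Iic 0, gaussianPDFReal 0 1 t := by
    ext x
    rw [← intervalIntegral.integral_Iic_sub_Iic hint.integrableOn hint.integrableOn, sub_add_cancel,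
      Phi_eq, measureReal_def, gaussianReal_apply_eq_integral 0 one_ne_zero,
      ENNReal.toReal_ofReal (integral_nonneg fun t => gaussianPDFReal_nonneg 0 1 t)]
  rw [h]
  exact (continuous_gaussianPDFReal.integral_hasStrictDerivAt 0 x).hasDerivAt.add_const _

lemma continuous_Phi : Continuous Phi :=
  continuous_iff_continuousAt.2 fun x => (hasDerivAt_Phi x).continuousAt

lemma Phi_nonneg (x : ℝ) : 0 ≤ Phi x := cdf_nonneg _ _

lemma Phi_le_one (x : ℝ) : Phi x ≤ 1 := cdf_le_one _ _

/-- Completing the square, both exponents equal `-(l²/2 + (x+t)/2 + (x-t)²/(8l²))`, which is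
symmetric in `x` and `t`. -/
lemma gaussianPDFReal_mul_exp_comm {l : ℝ} (hl : 0 < l) (x t : ℝ) :
    gaussianPDFReal 0 1 (l + (x - t) / (2 * l)) * Real.exp (-t) =
      gaussianPDFReal 0 1 (l + (t - x) / (2 * l)) * Real.exp (-x) := by
  simp only [gaussianPDFReal, mul_assoc, ← Real.exp_add]
  congr 2
  simp
  field_simp
  ring

/-- The integrand has the antiderivative `-(Φ(l + (x-t)/(2l)) e^{-t} + Φ(l + (t-x)/(2l)) e^{-x})`:
the two density terms in its derivative cancel by the symmetry above. Its limit at infinity is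
`-e^{-x}`. -/
lemma integral_exp_mul_Phi {l : ℝ} (hl : 0 < l) (x y : ℝ) :
    ∫ t in Set.Ioi y, Real.exp (-t) * Phi (l + (x - t) / (2 * l)) =
      Phi (l + (x - y) / (2 * l)) * Real.exp (-y) + Phi (l + (y - x) / (2 * l)) * Real.exp (-x)
        - Real.exp (-x) := by
  have hd (t : ℝ) : HasDerivAt (fun t => -(Phi (l + (x - t) / (2 * l)) * Real.exp (-t) +
      Phi (l + (t - x) / (2 * l)) * Real.exp (-x)))
      (Real.exp (-t) * Phi (l + (x - t) / (2 * l))) t := by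
    have h1 : HasDerivAt (fun t => l + (x - t) / (2 * l)) (-1 / (2 * l)) t :=
      (((hasDerivAt_id t).const_sub x).div_const _).const_add l
    have h2 : HasDerivAt (fun t => l + (t - x) / (2 * l)) (1 / (2 * l)) t :=
      (((hasDerivAt_id t).sub_const x).div_const _).const_add l
    have h3 : HasDerivAt (fun t : ℝ => Real.exp (-t)) (Real.exp (-t) * -1) t :=
      (hasDerivAt_neg t).exp
    have h4 := ((((hasDerivAt_Phi _).comp t h1).mul h3).add
      (((hasDerivAt_Phi _).comp t h2).mul_const (Real.exp (-x)))).neg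
    convert! h4 using 1
    have h5 := gaussianPDFReal_mul_exp_comm hl x t
    simp only [Function.comp]
    linear_combination (-1 / (2 * l)) * h5
  have hexp : Tendsto (fun t : ℝ => Real.exp (-t)) atTop (𝓝 0) :=
    Real.tendsto_exp_atBot.comp tendsto_neg_atTop_atBot
  have hlim : Tendsto (fun t => -(Phi (l + (x - t) / (2 * l)) * Real.exp (-t) +
      Phi (l + (t - x) / (2 * l)) * Real.exp (-x))) atTop (𝓝 (-(0 + 1 * Real.exp (-x)))) := by
    refine Tendsto.neg (Tendsto.add ?_ (Tendsto.mul_const _ ?_))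
    · refine squeeze_zero (fun t => mul_nonneg (Phi_nonneg _) (Real.exp_pos _).le) (fun t => ?_) hexp
      exact mul_le_of_le_one_left (Real.exp_pos _).le (Phi_le_one _)
    · refine (tendsto_cdf_atTop (gaussianReal 0 1)).comp ?_
      refine tendsto_atTop_add_const_left _ _ (Tendsto.atTop_div_const (by positivity) ?_)
      exact tendsto_atTop_add_const_right _ _ tendsto_id
  rw [integral_Ioi_of_hasDerivAt_of_tendsto (hd y).continuousAt.continuousWithinAt
    (fun t _ => hd t) ?_ hlim]
  · ring
  · refine (integrableOn_exp_neg_Ioi y).mono' (Continuous.aestronglyMeasurable ?_)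
      (ae_of_all _ fun t => ?_)
    · have := continuous_Phi
      fun_prop
    · rw [Real.norm_of_nonneg (mul_nonneg (Real.exp_pos _).le (Phi_nonneg _))]
      exact mul_le_of_le_one_right (Real.exp_pos _).le (Phi_le_one _)

lemma tendsto_one_sub_tailProb_pow {r : ℕ → ℝ} (hr : ∀ n, 2 ≤ n → r n ^ 2 ≤ 1) {lam : ℝ≥0∞}
    (hlam : HuslerReissCondition r lam) (x y : ℝ) :
    Tendsto (fun n : ℕ => (1 - tailProb n (r n) x y) ^ n) atTop (𝓝 (H lam x y)) := by
  suffices h : ∃ V, Tendsto (fun n : ℕ => n * tailProb n (r n) x y) atTop (𝓝 V) ∧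
      H lam x y = Real.exp (-V) by
    obtain ⟨V, hV, hH⟩ := h
    rw [hH]
    have := Real.tendsto_one_add_pow_exp_of_tendsto (g := fun n => -tailProb n (r n) x y) (t := -V)
      (by simpa using hV.neg)
    simpa [sub_eq_add_neg] using this
  unfold HuslerReissCondition at hlam
  rcases eq_or_ne lam ∞ with rfl | htop
  · have h1 : Tendsto (fun n : ℕ => (1 - r n) * Real.log n) atTop atTop := by
      rw [← EReal.tendsto_coe_nhds_top_iff]
      simpa using hlam
    refine ⟨_, tendsto_mul_tailProb (G := fun _ => 1)
      (ae_of_all _ fun t => tendsto_condProb_one hr h1 x t), ?_⟩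
    simp only [mul_one, integral_exp_neg_Ioi]
    simp [H, gumbel, ← Real.exp_add]
    ring
  have hl : Tendsto (fun n : ℕ => (1 - r n) * Real.log n) atTop (𝓝 (lam.toReal ^ 2)) := by
    rw [← EReal.tendsto_coe]
    convert! hlam using 2
    rw [← ENNReal.toReal_pow, EReal.coe_ennreal_toReal (ENNReal.pow_ne_top htop)]
  rcases eq_or_ne lam 0 with rfl | h0
  -- For `λ = 0` the limiting half-line is everything or empty, so `G` is the indicator of `t ≤ x`.
  -- Convergence may fail at the single point `t = x`, which is null.
  · refine ⟨_, tendsto_mul_tailProb (G := fun t =>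
      (gaussianReal 0 1).real {z | 2 * (0 : ℝ) * z ≤ 2 * 0 ^ 2 + (x - t)}) ?_, ?_⟩
    · have : ∀ᵐ t : ℝ, t ≠ x := by simp [ae_iff]
      filter_upwards [this] with t ht
      exact tendsto_condProb le_rfl (by simpa using hl) (Or.inr ht.symm)
    · have e1 : ∀ t, Real.exp (-t) * (gaussianReal 0 1).real
          {z | 2 * (0 : ℝ) * z ≤ 2 * 0 ^ 2 + (x - t)} =
          (Set.Iic x).indicator (fun t => Real.exp (-t)) t := by
        intro t
        by_cases ht : t ≤ x
        · rw [Set.indicator_of_mem (Set.mem_Iic.2 ht)]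
          simp [ht]
        · rw [Set.indicator_of_notMem (mt Set.mem_Iic.1 ht)]
          simp [ht]
      simp_rw [e1]
      rw [setIntegral_indicator measurableSet_Iic, Set.Ioi_inter_Iic]
      rcases le_total x y with hxy | hxy
      · rw [Set.Ioc_eq_empty (not_lt.2 hxy)]
        simp only [H, if_true, Measure.restrict_empty, integral_zero_measure, add_zero]
        rw [min_eq_left]
        · rfl
        · simp only [gumbel]; gcongr
      · rw [← intervalIntegral.integral_of_le hxy, ← intervalIntegral.integral_Ioi_sub_Ioi
          (integrableOn_exp_neg_Ioi y) hxy, integral_exp_neg_Ioi,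
          integral_exp_neg_Ioi]
        simp only [H, if_true]
        rw [min_eq_right]
        · simp [gumbel]
        · simp only [gumbel]; gcongr
  · have hpos : 0 < lam.toReal := ENNReal.toReal_pos h0 htop
    refine ⟨_, tendsto_mul_tailProb (G := fun t => Phi (lam.toReal + (x - t) / (2 * lam.toReal)))
      (ae_of_all _ fun t => ?_), ?_⟩
    · convert! tendsto_condProb (x := x) (t := t) hpos.le hl (Or.inl hpos.ne') using 2
      rw [Phi_eq]
      congr 1
      ext z
      simp only [Set.mem_Iic, Set.mem_ofPred_eq]
      rw [← mul_le_mul_iff_right₀ (by positivity : 0 < 2 * lam.toReal)]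
      have : 2 * lam.toReal * (lam.toReal + (x - t) / (2 * lam.toReal)) =
        2 * lam.toReal ^ 2 + (x - t) := by field_simp
      rw [this]
    · rw [integral_exp_mul_Phi hpos]
      simp only [H, h0, htop, if_false]
      congr 1
      ring

/-! ### Comparison with independent blocks -/

section Blocks

variable {κ τ : Type*} [Fintype κ] [Fintype τ] [DecidableEq κ] [DecidableEq τ]

/-- A Gaussian vector with blocks indexed by `κ` is compared with the vector that has the same
blocks in law, made independent of one another. -/
theorem abs_prod_measureReal_sub_le (μ : Measure (κ × τ → ℝ)) [IsGaussian μ]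
    (h0 : ∀ p, ∫ z, z p ∂μ = 0) (h1 : ∀ p, Var[fun z => z p; μ] = 1) {σ v : ℝ} {u : κ × τ → ℝ}
    (hcov : ∀ p q, p.1 ≠ q.1 → |cov[fun z => z p, fun z => z q; μ]| ≤ σ) (hσ : σ < 1)
    (hv : 0 ≤ v) (hu : ∀ p, v ≤ u p) :
    |∏ k, μ.real {z | ∀ i, z (k, i) ≤ u (k, i)} - μ.real {z | ∀ p, z p ≤ u p}| ≤
      (∑ p, ∑ q, if p.1 = q.1 then 0 else |cov[fun z => z p, fun z => z q; μ]| *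
        (1 / (2 * Real.pi * √(1 - σ ^ 2)) *
          Real.exp (-v ^ 2 / (1 + |cov[fun z => z p, fun z => z q; μ]|)))) * (Real.pi / 2) := by
  set ν : Measure (κ → κ × τ → ℝ) := Measure.pi fun _ => μ with hν
  have hνg : IsGaussian ν := by
    have hi : iIndepFun (fun (k : κ) (w : κ → κ × τ → ℝ) => w k) ν :=
      iIndepFun_pi (μ := fun _ : κ => μ) (X := fun _ z => z) fun _ => aemeasurable_id
    have hmap (k : κ) : ν.map (fun w => w k) = μ := (measurePreserving_eval (fun _ : κ => μ) k).map_eq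
    have := hi.hasGaussianLaw fun k => ⟨by rw [hmap]; infer_instance⟩
    have h := this.isGaussian_map
    rwa [show (fun (w : κ → κ × τ → ℝ) (k : κ) => w k) = id from rfl, Measure.map_id] at h
  set Q := μ.prod ν with hQ
  set ξ : κ × τ → (κ × τ → ℝ) × (κ → κ × τ → ℝ) → ℝ := fun p ω => ω.1 p with hξ
  -- Coordinate `p` is read off the copy of the vector numbered by its block `p.1`. Each block keeps
  -- its law, and different blocks come from independent copies.
  set η : κ × τ → (κ × τ → ℝ) × (κ → κ × τ → ℝ) → ℝ := fun p ω => ω.2 p.1 p with hη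
  have hfst : MeasurePreserving (Prod.fst : _ × (κ → κ × τ → ℝ) → (κ × τ → ℝ)) Q μ :=
    measurePreserving_fst
  have hsnd : MeasurePreserving (Prod.snd : (κ × τ → ℝ) × _ → (κ → κ × τ → ℝ)) Q ν :=
    measurePreserving_snd
  have heval (k : κ) : MeasurePreserving
      (fun ω : (κ × τ → ℝ) × (κ → κ × τ → ℝ) => ω.2 k) Q μ :=
    (measurePreserving_eval (fun _ : κ => μ) k).comp hsnd
  have hlin : HasGaussianLaw (fun ω => ((fun i => ξ i ω), fun i => η i ω)) Q :=
    (IsGaussian.hasGaussianLaw_id (μ := Q)).map_fun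
      ((ContinuousLinearMap.fst ℝ (κ × τ → ℝ) (κ → κ × τ → ℝ)).prod
        (ContinuousLinearMap.pi fun p : κ × τ =>
          (ContinuousLinearMap.proj (R := ℝ) (φ := fun _ : κ × τ => ℝ) p).comp
            ((ContinuousLinearMap.proj (R := ℝ) (φ := fun _ : κ => κ × τ → ℝ) p.1).comp
              (ContinuousLinearMap.snd ℝ (κ × τ → ℝ) (κ → κ × τ → ℝ)))))
  have hpm (p : κ × τ) : Measurable fun z : κ × τ → ℝ => z p := measurable_pi_apply p
  have hξm (p : κ × τ) : Measurable (ξ p) := (hpm p).comp measurable_fst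
  have hηm (p : κ × τ) : Measurable (η p) := (hpm p).comp (heval p.1).measurable
  have hL2 (p : κ × τ) : MemLp (fun z : κ × τ → ℝ => z p) 2 μ :=
    ((IsGaussian.hasGaussianLaw_id (μ := μ)).map_fun
      (ContinuousLinearMap.proj (R := ℝ) (φ := fun _ : κ × τ => ℝ) p)).memLp_two
  have hξ0 (p : κ × τ) : ∫ ω, ξ p ω ∂Q = 0 := by
    rw [← h0 p, ← hfst.map_eq, integral_map hfst.measurable.aemeasurable
      (hpm p).aestronglyMeasurable]
  have hη0 (p : κ × τ) : ∫ ω, η p ω ∂Q = 0 := by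
    rw [← h0 p, ← (heval p.1).map_eq, integral_map (heval p.1).measurable.aemeasurable
      (hpm p).aestronglyMeasurable]
  have hξc (p q : κ × τ) : cov[ξ p, ξ q; Q] = cov[fun z => z p, fun z => z q; μ] := by
    rw [← hfst.map_eq, covariance_map_fun (hpm p).aestronglyMeasurable
      (hpm q).aestronglyMeasurable hfst.measurable.aemeasurable]
  have hηc (p q : κ × τ) (hpq : p.1 = q.1) :
      cov[η p, η q; Q] = cov[fun z => z p, fun z => z q; μ] := by
    rw [← (heval p.1).map_eq, covariance_map_fun (hpm p).aestronglyMeasurable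
      (hpm q).aestronglyMeasurable (heval p.1).measurable.aemeasurable]
    simp only [hη, hpq]
  have hηc' (p q : κ × τ) (hpq : p.1 ≠ q.1) : cov[η p, η q; Q] = 0 := by
    have hi : iIndepFun (fun (k : κ) (w : κ → κ × τ → ℝ) => w k) ν :=
      iIndepFun_pi (μ := fun _ : κ => μ) (X := fun _ z => z) fun _ => aemeasurable_id
    have h2 : cov[fun w => w p.1 p, fun w => w q.1 q; ν] = 0 :=
      ((hi.indepFun hpq).comp (hpm p) (hpm q)).covariance_eq_zero
        ((hL2 p).comp_measurePreserving (measurePreserving_eval (fun _ : κ => μ) p.1))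
        ((hL2 q).comp_measurePreserving (measurePreserving_eval (fun _ : κ => μ) q.1))
    rw [← h2, ← hsnd.map_eq, covariance_map_fun _ _ hsnd.measurable.aemeasurable]
    · exact ((hpm p).comp (measurable_pi_apply p.1)).aestronglyMeasurable
    · exact ((hpm q).comp (measurable_pi_apply q.1)).aestronglyMeasurable
  have hξ1 (p : κ × τ) : Var[ξ p; Q] = 1 := by
    rw [← covariance_self (hξm p).aemeasurable, hξc, covariance_self (hpm p).aemeasurable, h1]
  have hη1 (p : κ × τ) : Var[η p; Q] = 1 := by
    rw [← covariance_self (hηm p).aemeasurable, hηc p p rfl, covariance_self (hpm p).aemeasurable,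
      h1]
  have hξη (p q : κ × τ) : cov[ξ p, η q; Q] = 0 :=
    covariance_fst_snd_prod (hL2 p)
      ((hL2 q).comp_measurePreserving (measurePreserving_eval (fun _ : κ => μ) q.1))
  have key := abs_measureReal_sub_le (P := Q) (σ := σ) hlin hξm hηm hξ0 hη0 hξ1 hη1 hξη
    (fun p q _ => by
      rcases eq_or_ne p.1 q.1 with h | h
      · left; rw [hξc, hηc p q h]
      · right; exact ⟨hηc' p q h, by rw [hξc]; exact hcov p q h⟩) hσ hv hu
  have e1 : Q.real {ω | ∀ p, ξ p ω ≤ u p} = μ.real {z | ∀ p, z p ≤ u p} := by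
    have hs : MeasurableSet {z : κ × τ → ℝ | ∀ p, z p ≤ u p} := by
      rw [Set.ofPred_forall]
      exact MeasurableSet.iInter fun p => measurableSet_le (hpm p) measurable_const
    rw [measureReal_def, measureReal_def, ← hfst.measure_preimage hs.nullMeasurableSet]
    rfl
  have e2 : Q.real {ω | ∀ p, η p ω ≤ u p} = ∏ k, μ.real {z | ∀ i, z (k, i) ≤ u (k, i)} := by
    have hs (k : κ) : MeasurableSet {z : κ × τ → ℝ | ∀ i, z (k, i) ≤ u (k, i)} := by
      rw [Set.ofPred_forall]
      exact MeasurableSet.iInter fun i => measurableSet_le (hpm _) measurable_const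
    have hset : {ω : (κ × τ → ℝ) × (κ → κ × τ → ℝ) | ∀ p, η p ω ≤ u p} =
        Prod.snd ⁻¹' (Set.univ.pi fun k => {z : κ × τ → ℝ | ∀ i, z (k, i) ≤ u (k, i)}) := by
      ext ω
      simp [hη, Prod.forall]
    rw [hset, measureReal_def, hsnd.measure_preimage
      (MeasurableSet.univ_pi hs).nullMeasurableSet, hν, Measure.pi_pi, ENNReal.toReal_prod]
    rfl
  rw [e1, e2] at key
  refine key.trans (mul_le_mul_of_nonneg_right (Finset.sum_le_sum fun p _ => ?_) (by positivity))
  refine (Finset.sum_le_sum fun q _ => le_of_eq ?_).trans (Finset.sum_le_sum_of_subset_of_nonneg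
    (Finset.erase_subset p Finset.univ) fun q _ _ => by split_ifs <;> positivity)
  split_ifs with h
  · rw [hξc, hηc p q h]; simp
  · rw [hξc, hηc' p q h, sub_zero]

end Blocks

/-! ### Uniform convergence -/

/-- Near `p`, monotonicity traps `F n` between its values at two opposite corners of a small square;
there `F n` converges and `G` is close to `G p`. Compactness makes this uniform. -/
lemma tendstoUniformlyOn_of_monotone {F : ℕ → ℝ × ℝ → ℝ} {G : ℝ × ℝ → ℝ}
    (hmono : ∀ n, Monotone (F n)) (hG : Continuous G)
    (hlim : ∀ p, Tendsto (fun n => F n p) atTop (𝓝 (G p))) {K : Set (ℝ × ℝ)} (hK : IsCompact K) :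
    TendstoUniformlyOn F G atTop K := by
  rw [← tendstoLocallyUniformlyOn_iff_tendstoUniformlyOn_of_compact hK,
    Metric.tendstoLocallyUniformlyOn_iff]
  intro ε hε p _
  obtain ⟨δ, hδ, hδG⟩ := Metric.continuous_iff.1 hG p (ε / 3) (by positivity)
  have hδ2 : 0 < δ / 2 := by positivity
  set p₁ : ℝ × ℝ := (p.1 - δ / 2, p.2 - δ / 2) with hp₁
  set p₂ : ℝ × ℝ := (p.1 + δ / 2, p.2 + δ / 2) with hp₂
  have hd₁ : dist p₁ p < δ := by
    simpa [hp₁, Prod.dist_eq, abs_of_pos hδ] using hδ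
  have hd₂ : dist p₂ p < δ := by
    simpa [hp₂, Prod.dist_eq, abs_of_pos hδ] using hδ
  refine ⟨Metric.ball p (δ / 2), mem_nhdsWithin_of_mem_nhds (Metric.ball_mem_nhds p hδ2), ?_⟩
  filter_upwards [Metric.tendsto_nhds.1 (hlim p₁) (ε / 3) (by positivity),
    Metric.tendsto_nhds.1 (hlim p₂) (ε / 3) (by positivity)] with n hn₁ hn₂ q hq
  have hq' := Metric.mem_ball.1 hq
  rw [Prod.dist_eq, max_lt_iff, Real.dist_eq, Real.dist_eq, abs_lt, abs_lt] at hq'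
  have hle₁ : p₁ ≤ q := ⟨by simp only [hp₁]; linarith, by simp only [hp₁]; linarith⟩
  have hle₂ : q ≤ p₂ := ⟨by simp only [hp₂]; linarith, by simp only [hp₂]; linarith⟩
  have a1 := hmono n hle₁
  have a2 := hmono n hle₂
  have b1 := hδG p₁ hd₁
  have b2 := hδG p₂ hd₂
  have b3 := hδG q ((Metric.mem_ball.1 hq).trans (by linarith))
  rw [Real.dist_eq, abs_lt] at b1 b2 b3 hn₁ hn₂
  rw [Real.dist_eq, abs_lt]
  constructor <;> linarith

/-- Pólya's theorem for bivariate distribution functions. -/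
lemma tendsto_iSup_abs_sub {F : ℕ → ℝ × ℝ → ℝ} {G : ℝ × ℝ → ℝ}
    (hmono : ∀ n, Monotone (F n)) (hF0 : ∀ n p, 0 ≤ F n p)
    (htail : ∀ n x y L, F n (x, y) ≤ F n (min x L, min y L) + (1 - F n (L, L)))
    (hG : Continuous G) (hlim : ∀ p, Tendsto (fun n => F n p) atTop (𝓝 (G p)))
    (hG1 : Tendsto (fun L => G (L, L)) atTop (𝓝 1))
    (hG2 : Tendsto (fun L => G (-L, L)) atTop (𝓝 0))
    (hG3 : Tendsto (fun L => G (L, -L)) atTop (𝓝 0)) :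
    Tendsto (fun n => ⨆ p, |F n p - G p|) atTop (𝓝 0) := by
  have hGmono : Monotone G := fun p q hpq =>
    le_of_tendsto_of_tendsto' (hlim p) (hlim q) fun n => hmono n hpq
  have hG0 (p : ℝ × ℝ) : 0 ≤ G p := ge_of_tendsto' (hlim p) fun n => hF0 n p
  have hGtail (x y L : ℝ) : G (x, y) ≤ G (min x L, min y L) + (1 - G (L, L)) :=
    le_of_tendsto_of_tendsto' (hlim _) ((hlim _).add ((hlim _).const_sub 1))
      fun n => htail n x y L
  rw [Metric.tendsto_nhds]
  intro ε hε
  -- On `[-L, L]²` convergence is uniform; to the left of it or below it, both functions are less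
  -- than `ε / 24`; beyond `L`, truncating the arguments costs at most `1 - F n (L, L)` or `1 - G
  -- (L, L)`, each less than `ε / 24`.
  obtain ⟨L, hL1, hL2, hL3⟩ := ((hG1.eventually_const_lt (by linarith : 1 - ε / 24 < 1)).and
    ((hG2.eventually_lt_const (by positivity : 0 < ε / 24)).and
      (hG3.eventually_lt_const (by positivity : 0 < ε / 24)))).exists
  have hunif := tendstoUniformlyOn_of_monotone hmono hG hlim
    (isCompact_Icc (a := ((-L, -L) : ℝ × ℝ)) (b := (L, L)))
  filter_upwards [Metric.tendstoUniformlyOn_iff.1 hunif (ε / 4) (by positivity),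
    (hlim (L, L)).eventually_const_lt hL1, (hlim (-L, L)).eventually_lt_const hL2,
    (hlim (L, -L)).eventually_lt_const hL3] with n hn h1 h2 h3
  have hbox (x y : ℝ) (hx : x ≤ L) (hy : y ≤ L) : |F n (x, y) - G (x, y)| ≤ ε / 4 := by
    by_cases hxL : -L ≤ x
    · by_cases hyL : -L ≤ y
      · have := hn (x, y) ⟨⟨hxL, hyL⟩, ⟨hx, hy⟩⟩
        rw [dist_comm, Real.dist_eq] at this
        exact this.le
      · have i1 : F n (x, y) ≤ F n (L, -L) := hmono n ⟨hx, (not_le.1 hyL).le⟩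
        have i2 : G (x, y) ≤ G (L, -L) := hGmono ⟨hx, (not_le.1 hyL).le⟩
        have i3 := hF0 n (x, y)
        have i4 := hG0 (x, y)
        rw [abs_le]
        constructor <;> linarith
    · have i1 : F n (x, y) ≤ F n (-L, L) := hmono n ⟨(not_le.1 hxL).le, hy⟩
      have i2 : G (x, y) ≤ G (-L, L) := hGmono ⟨(not_le.1 hxL).le, hy⟩
      have i3 := hF0 n (x, y)
      have i4 := hG0 (x, y)
      rw [abs_le]
      constructor <;> linarith
  have hall : ⨆ p, |F n p - G p| ≤ ε / 2 := by
    refine ciSup_le fun p => ?_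
    obtain ⟨x, y⟩ := p
    have i1 := htail n x y L
    have i2 := hGtail x y L
    have i3 : F n (min x L, min y L) ≤ F n (x, y) := hmono n ⟨min_le_left _ _, min_le_left _ _⟩
    have i4 : G (min x L, min y L) ≤ G (x, y) := hGmono ⟨min_le_left _ _, min_le_left _ _⟩
    have i5 := abs_le.1 (hbox (min x L) (min y L) (min_le_right _ _) (min_le_right _ _))
    rw [abs_le]
    constructor <;> linarith
  rw [Real.dist_eq, sub_zero, abs_of_nonneg (Real.iSup_nonneg fun p => abs_nonneg _)]
  linarith

lemma H_symm (lam : ℝ≥0∞) (x y : ℝ) : H lam x y = H lam y x := by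
  simp only [H]
  split_ifs
  · exact min_comm _ _
  · exact mul_comm _ _
  · congr 1; ring

lemma continuous_gumbel : Continuous gumbel := by
  unfold gumbel
  fun_prop

lemma gumbel_le_one (x : ℝ) : gumbel x ≤ 1 := by
  rw [gumbel, Real.exp_le_one_iff, neg_nonpos]
  positivity

lemma gumbel_pos (x : ℝ) : 0 < gumbel x := Real.exp_pos _

lemma continuous_H (lam : ℝ≥0∞) : Continuous fun p : ℝ × ℝ => H lam p.1 p.2 := by
  have h1 := continuous_gumbel
  have h2 := continuous_Phi
  simp only [H]
  split_ifs
  · fun_prop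
  · fun_prop
  · fun_prop

lemma H_le_gumbel (lam : ℝ≥0∞) (x y : ℝ) : H lam x y ≤ gumbel x := by
  simp only [H]
  split_ifs with h0 htop
  · exact min_le_left _ _
  · exact mul_le_of_le_one_right (gumbel_pos x).le (gumbel_le_one y)
  · have h := integral_exp_mul_Phi (ENNReal.toReal_pos h0 htop) x y
    have h2 : 0 ≤ ∫ t in Set.Ioi y, Real.exp (-t) * Phi (lam.toReal + (x - t) / (2 * lam.toReal)) :=
      integral_nonneg fun t => mul_nonneg (Real.exp_pos _).le (Phi_nonneg _)
    rw [gumbel, Real.exp_le_exp]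
    linarith

lemma gumbel_mul_gumbel_le_H (lam : ℝ≥0∞) (x y : ℝ) : gumbel x * gumbel y ≤ H lam x y := by
  simp only [H]
  split_ifs with h0 htop
  · exact le_min (mul_le_of_le_one_right (gumbel_pos x).le (gumbel_le_one y))
      (mul_le_of_le_one_left (gumbel_pos y).le (gumbel_le_one x))
  · exact le_rfl
  · rw [gumbel, gumbel, ← Real.exp_add, Real.exp_le_exp]
    have h1 := mul_le_of_le_one_left (Real.exp_pos (-y)).le
      (Phi_le_one (lam.toReal + (x - y) / (2 * lam.toReal)))
    have h2 := mul_le_of_le_one_left (Real.exp_pos (-x)).le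
      (Phi_le_one (lam.toReal + (y - x) / (2 * lam.toReal)))
    linarith

lemma tendsto_gumbel_atTop : Tendsto gumbel atTop (𝓝 1) := by
  have h : Tendsto (fun x : ℝ => Real.exp (-x)) atTop (𝓝 0) :=
    Real.tendsto_exp_atBot.comp tendsto_neg_atTop_atBot
  have := (Real.continuous_exp.tendsto _).comp h.neg
  simpa [gumbel, Function.comp_def] using! this

lemma tendsto_gumbel_neg_atTop : Tendsto (fun L => gumbel (-L)) atTop (𝓝 0) := by
  have h := Real.tendsto_exp_atBot.comp (tendsto_neg_atTop_atBot.comp Real.tendsto_exp_atTop)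
  simpa [gumbel, Function.comp_def] using h

lemma H_nonneg (lam : ℝ≥0∞) (x y : ℝ) : 0 ≤ H lam x y :=
  (mul_nonneg (gumbel_pos x).le (gumbel_pos y).le).trans (gumbel_mul_gumbel_le_H lam x y)

lemma tendsto_H_atTop (lam : ℝ≥0∞) : Tendsto (fun L => H lam L L) atTop (𝓝 1) :=
  tendsto_of_tendsto_of_tendsto_of_le_of_le
    (by simpa using tendsto_gumbel_atTop.mul tendsto_gumbel_atTop) tendsto_const_nhds
    (fun L => gumbel_mul_gumbel_le_H lam L L)
    (fun L => (H_le_gumbel lam L L).trans (gumbel_le_one L))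

lemma tendsto_H_neg_atTop (lam : ℝ≥0∞) : Tendsto (fun L => H lam (-L) L) atTop (𝓝 0) :=
  squeeze_zero (fun _ => H_nonneg lam _ _) (fun _ => H_le_gumbel lam _ _) tendsto_gumbel_neg_atTop

/-! ### The Gaussian array -/

section Array

lemma card_filter_natAbs_sub_lt {n : ℕ} (k : Fin n) (I : ℕ) :
    (Finset.univ.filter fun l : Fin n => ((k : ℤ) - (l : ℤ)).natAbs < I).card ≤ 2 * I := by
  have h : (Finset.univ.filter fun l : Fin n => ((k : ℤ) - (l : ℤ)).natAbs < I).card ≤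
      (Finset.Ioo ((k : ℤ) - I) ((k : ℤ) + I)).card := by
    refine Finset.card_le_card_of_injOn (fun l : Fin n => (l : ℤ)) (fun l hl => ?_) ?_
    · simp only [Finset.coe_filter, Finset.mem_univ, true_and, Set.mem_ofPred_eq] at hl
      simp only [Finset.coe_Ioo, Set.mem_Ioo]
      omega
    · intro l _ l' _ h
      ext
      simpa using h
  refine h.trans ?_
  rw [Int.card_Ioo]
  omega

/-- Each of the `2n` indices has at most `2 · 2I` near partners, giving `8nI`; the far bound is
charged to all `(2n)²` pairs. -/
lemma sum_sum_le_of_near_far {n I : ℕ} {e₁ e₂ : ℝ} (he₁ : 0 ≤ e₁)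
    {f : Fin n × Fin 2 → Fin n × Fin 2 → ℝ}
    (hf : ∀ p q, f p q ≤ (if ((p.1 : ℤ) - (q.1 : ℤ)).natAbs < I then e₁ else 0) + e₂) :
    ∑ p, ∑ q, f p q ≤ 8 * (n * I * e₁) + 4 * (n ^ 2 * e₂) := by
  have h (p : Fin n × Fin 2) : ∑ q, f p q ≤ 4 * I * e₁ + 2 * n * e₂ := by
    refine (Finset.sum_le_sum fun q _ => hf p q).trans ?_
    have hc : ((Finset.univ.filter fun l : Fin n => ((p.1 : ℤ) - (l : ℤ)).natAbs < I).card : ℝ) ≤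
        2 * I := by exact_mod_cast card_filter_natAbs_sub_lt p.1 I
    have hs : ∑ q : Fin n × Fin 2, (if ((p.1 : ℤ) - (q.1 : ℤ)).natAbs < I then e₁ else 0) =
        2 * ((Finset.univ.filter fun l : Fin n =>
          ((p.1 : ℤ) - (l : ℤ)).natAbs < I).card * e₁) := by
      rw [Fintype.sum_prod_type]
      simp only [Fin.sum_univ_two]
      rw [Finset.sum_add_distrib, ← Finset.sum_filter, Finset.sum_const, nsmul_eq_mul, two_mul]
    rw [Finset.sum_add_distrib, hs]
    simp only [Finset.sum_const, Finset.card_univ, Fintype.card_fin, Fintype.card_prod,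
      nsmul_eq_mul]
    push_cast
    linarith [mul_le_mul_of_nonneg_right hc he₁]
  refine (Finset.sum_le_sum fun p _ => h p).trans (le_of_eq ?_)
  simp only [Finset.sum_const, Finset.card_univ, Fintype.card_fin, Fintype.card_prod, nsmul_eq_mul]
  push_cast
  ring

variable {Ω : Type*} [MeasurableSpace Ω] {P : Measure Ω}
  {X : (n : ℕ) → Fin n → Fin 2 → Ω → ℝ} {ρ₀ : ℕ → ℝ} {ρ : Fin 2 → Fin 2 → ℕ → ℕ → ℝ}

namespace IsStationaryGaussianArray

lemma hasGaussianLaw (hX : IsStationaryGaussianArray P X ρ₀ ρ) (n : ℕ) (k : Fin n) (i : Fin 2) : HasGaussianLaw (X n k i) P :=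
  (hX.gaussian n).eval (X := fun p ω => X n p.1 p.2 ω) (k, i)

lemma covariance_eq_corr (hX : IsStationaryGaussianArray P X ρ₀ ρ) (n : ℕ) (k l : Fin n) (i j : Fin 2) :
    cov[X n k i, X n l j; P] = corr P (X n k i) (X n l j) := by
  rw [corr, hX.variance_one, hX.variance_one]
  simp

variable [IsProbabilityMeasure P]

lemma corr_sq_le_one (hX : IsStationaryGaussianArray P X ρ₀ ρ) (n : ℕ) (k l : Fin n) (i j : Fin 2) :
    corr P (X n k i) (X n l j) ^ 2 ≤ 1 :=
  covariance_sq_le_one (hX.hasGaussianLaw n k i).memLp_two (hX.hasGaussianLaw n l j).memLp_two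
    (hX.variance_one n k i) (hX.variance_one n l j) (hX.covariance_eq_corr n k l i j)

lemma rho_zero_sq_le_one (hX : IsStationaryGaussianArray P X ρ₀ ρ) {n : ℕ} (hn : 2 ≤ n) : ρ₀ n ^ 2 ≤ 1 := by
  rw [← hX.corr_same n ⟨0, by omega⟩]
  exact hX.corr_sq_le_one _ _ _ _ _

lemma abs_rho_le_one (hX : IsStationaryGaussianArray P X ρ₀ ρ) {n k : ℕ} (hk : 1 ≤ k) (hkn : k < n) (i j : Fin 2) : |ρ i j k n| ≤ 1 := by
  have h := hX.corr_ne n ⟨k, hkn⟩ ⟨0, by omega⟩ (by simp [Fin.ext_iff]; omega) i j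
  have e : (((⟨k, hkn⟩ : Fin n) : ℤ) - ((⟨0, by omega⟩ : Fin n) : ℤ)).natAbs = k := by simp
  rw [e] at h
  rw [← sq_le_one_iff_abs_le_one, ← h]
  exact hX.corr_sq_le_one _ _ _ _ _

lemma abs_rho_le_maxCorr (hX : IsStationaryGaussianArray P X ρ₀ ρ) {n k : ℕ} (hk : 1 ≤ k) (hkn : k < n) (i j : Fin 2) :
    |ρ i j k n| ≤ maxCorr ρ := by
  -- Boundedness comes from Cauchy–Schwarz for the array; for an unbounded set `sSup` would be the
  -- default `0`.
  refine le_csSup ⟨1, ?_⟩ ⟨i, j, k, n, hk, hkn, rfl⟩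
  rintro _ ⟨i, j, k, n, hk, hkn, rfl⟩
  exact hX.abs_rho_le_one hk hkn i j

lemma abs_rho_le_tailMaxCorr (hX : IsStationaryGaussianArray P X ρ₀ ρ) {m n k : ℕ} (hm : 1 ≤ m) (hk : m ≤ k) (hkn : k < n) (i j : Fin 2) :
    |ρ i j k n| ≤ tailMaxCorr ρ m n := by
  refine le_csSup ⟨1, ?_⟩ ⟨i, j, k, hk, hkn, rfl⟩
  rintro _ ⟨i, j, k, hk, hkn, rfl⟩
  exact hX.abs_rho_le_one (hm.trans hk) hkn i j

end IsStationaryGaussianArray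

variable [IsProbabilityMeasure P]

lemma maxCorr_nonneg (ρ : Fin 2 → Fin 2 → ℕ → ℕ → ℝ) : 0 ≤ maxCorr ρ := by
  refine Real.sSup_nonneg ?_
  rintro _ ⟨i, j, k, n, -, -, rfl⟩
  exact abs_nonneg _

lemma tailMaxCorr_nonneg (ρ : Fin 2 → Fin 2 → ℕ → ℕ → ℝ) (m n : ℕ) : 0 ≤ tailMaxCorr ρ m n := by
  refine Real.sSup_nonneg ?_
  rintro _ ⟨i, j, k, -, -, rfl⟩
  exact abs_nonneg _

lemma rowMax_le_iff {Ω : Type*} (X : (n : ℕ) → Fin n → Fin 2 → Ω → ℝ) {n : ℕ} (hn : 1 ≤ n)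
    (i : Fin 2) (ω : Ω) (s : ℝ) : rowMax X n i ω ≤ s ↔ ∀ k, X n k i ω ≤ s := by
  have : Nonempty (Fin n) := ⟨⟨0, hn⟩⟩
  exact ciSup_le_iff (Set.finite_range _).bddAbove

/-- The joint law of the two row maxima is compared with that for independent vectors. -/
lemma abs_measureReal_rowMax_sub_le (hX : IsStationaryGaussianArray P X ρ₀ ρ)
    (hρ : maxCorr ρ < 1) {n I : ℕ} (hn : 2 ≤ n) (hI : 1 ≤ I) {x y : ℝ} (hu : 0 ≤ u n (min x y)) :
    |(1 - tailProb n (ρ₀ n) x y) ^ n -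
        P.real {ω | rowMax X n 0 ω ≤ u n x ∧ rowMax X n 1 ω ≤ u n y}| ≤
      (8 * (n * I * Real.exp (-u n (min x y) ^ 2 / (1 + maxCorr ρ))) +
        4 * (n ^ 2 * (tailMaxCorr ρ I n *
          Real.exp (-u n (min x y) ^ 2 / (1 + tailMaxCorr ρ I n))))) *
      (1 / (2 * Real.pi * √(1 - maxCorr ρ ^ 2)) * (Real.pi / 2)) := by
  set R : Ω → Fin n × Fin 2 → ℝ := fun ω p => X n p.1 p.2 ω with hR
  have hRg : HasGaussianLaw R P := hX.gaussian n
  have hRm : AEMeasurable R P := hRg.aemeasurable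
  set μ := P.map R with hμ
  have hμg : IsGaussian μ := hRg.isGaussian_map
  have hpm (p : Fin n × Fin 2) : Measurable fun z : Fin n × Fin 2 → ℝ => z p := measurable_pi_apply p
  have h0 (p : Fin n × Fin 2) : ∫ z, z p ∂μ = 0 := by
    rw [hμ, integral_map hRm (hpm p).aestronglyMeasurable]
    exact hX.mean_zero n p.1 p.2
  have hcov (p q : Fin n × Fin 2) : cov[fun z => z p, fun z => z q; μ] =
      corr P (X n p.1 p.2) (X n q.1 q.2) := by
    rw [hμ, covariance_map_fun (hpm p).aestronglyMeasurable (hpm q).aestronglyMeasurable hRm]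
    exact hX.covariance_eq_corr n p.1 q.1 p.2 q.2
  have h1 (p : Fin n × Fin 2) : Var[fun z => z p; μ] = 1 := by
    rw [hμ, variance_map (hpm p).aemeasurable hRm]
    exact hX.variance_one n p.1 p.2
  have hdist (k l : Fin n) (hkl : k ≠ l) :
      1 ≤ ((k : ℤ) - (l : ℤ)).natAbs ∧ ((k : ℤ) - (l : ℤ)).natAbs < n := by
    have := Fin.val_ne_of_ne hkl
    have := k.2
    have := l.2
    omega
  set σ := maxCorr ρ with hσ
  have hσ0 : 0 ≤ σ := maxCorr_nonneg ρ
  set v := u n (min x y) with hv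
  set thr : Fin n × Fin 2 → ℝ := fun p => if p.2 = 0 then u n x else u n y with hthr
  have hvthr (p : Fin n × Fin 2) : v ≤ thr p := by
    simp only [hthr]
    split_ifs
    · exact u_mono n (min_le_left _ _)
    · exact u_mono n (min_le_right _ _)
  have key := abs_prod_measureReal_sub_le μ h0 h1 (σ := σ) (v := v) (u := thr)
    (fun p q hpq => by
      rw [hcov, hX.corr_ne n p.1 q.1 hpq]
      exact hX.abs_rho_le_maxCorr (hdist _ _ hpq).1 (hdist _ _ hpq).2 _ _) hρ hu hvthr
  have e1 : μ.real {z | ∀ p, z p ≤ thr p} =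
      P.real {ω | rowMax X n 0 ω ≤ u n x ∧ rowMax X n 1 ω ≤ u n y} := by
    have hs : MeasurableSet {z : Fin n × Fin 2 → ℝ | ∀ p, z p ≤ thr p} := by
      rw [Set.ofPred_forall]
      exact MeasurableSet.iInter fun p => measurableSet_le (hpm p) measurable_const
    rw [measureReal_def, measureReal_def, hμ, Measure.map_apply_of_aemeasurable hRm hs]
    congr 2
    ext ω
    simp only [Set.mem_preimage, Set.mem_ofPred_eq, rowMax_le_iff X (by omega : 1 ≤ n),
      Prod.forall, Fin.forall_fin_two, hR, hthr]
    simp [forall_and]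
  have e2 (k : Fin n) : μ.real {z | ∀ i, z (k, i) ≤ thr (k, i)} = 1 - tailProb n (ρ₀ n) x y := by
    have hs : MeasurableSet {z : Fin n × Fin 2 → ℝ | ∀ i, z (k, i) ≤ thr (k, i)} := by
      rw [Set.ofPred_forall]
      exact MeasurableSet.iInter fun i => measurableSet_le (hpm _) measurable_const
    -- The second component comes first: the tail formula integrates over the component with
    -- threshold `u n y`.
    have hg : HasGaussianLaw (fun ω => (X n k 1 ω, X n k 0 ω)) P :=
      (hX.gaussian n).prodMk (X := fun p ω => X n p.1 p.2 ω) (k, 1) (k, 0)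
    rw [← measureReal_le_and_le hn hg (hX.mean_zero n k 1) (hX.mean_zero n k 0)
      (hX.variance_one n k 1) (hX.variance_one n k 0)
      (by rw [covariance_comm, hX.covariance_eq_corr, hX.corr_same]) x y,
      measureReal_def, measureReal_def, hμ, Measure.map_apply_of_aemeasurable hRm hs]
    congr 2
    ext ω
    simp [Fin.forall_fin_two, hR, hthr]
  rw [e1, Finset.prod_congr rfl fun k _ => e2 k, Finset.prod_const, Finset.card_univ,
    Fintype.card_fin] at key
  refine key.trans ?_
  set K := 1 / (2 * Real.pi * √(1 - σ ^ 2)) with hK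
  have hK0 : 0 ≤ K := by positivity
  set δ := tailMaxCorr ρ I n with hδ
  have hδ0 : 0 ≤ δ := tailMaxCorr_nonneg ρ I n
  rw [← mul_assoc]
  refine mul_le_mul_of_nonneg_right ?_ (by positivity)
  have hsum := sum_sum_le_of_near_far (n := n) (I := I)
    (e₁ := K * Real.exp (-v ^ 2 / (1 + σ))) (e₂ := K * (δ * Real.exp (-v ^ 2 / (1 + δ))))
    (by positivity)
    (f := fun p q => if p.1 = q.1 then 0 else |cov[fun z => z p, fun z => z q; μ]| *
        (K * Real.exp (-v ^ 2 / (1 + |cov[fun z => z p, fun z => z q; μ]|)))) ?_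
  · refine hsum.trans (le_of_eq ?_)
    ring
  intro p q
  have hmono {c d : ℝ} (hc : 0 ≤ c) (hcd : c ≤ d) :
      Real.exp (-v ^ 2 / (1 + c)) ≤ Real.exp (-v ^ 2 / (1 + d)) := by
    refine Real.exp_le_exp.2 ?_
    rw [neg_div, neg_div, neg_le_neg_iff]
    gcongr
  have he2 : 0 ≤ K * (δ * Real.exp (-v ^ 2 / (1 + δ))) := by positivity
  have he1 : 0 ≤ K * Real.exp (-v ^ 2 / (1 + σ)) := by positivity
  rcases eq_or_ne p.1 q.1 with hpq | hpq
  · simp only [hpq, if_true]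
    refine add_nonneg ?_ he2
    split_ifs
    · exact he1
    · exact le_rfl
  simp only [hpq, if_false]
  rw [hcov, hX.corr_ne n p.1 q.1 hpq]
  obtain ⟨hd1, hdn⟩ := hdist _ _ hpq
  set d := ((p.1 : ℤ) - (q.1 : ℤ)).natAbs with hd
  have hc0 := abs_nonneg (ρ p.2 q.2 d n)
  have hcσ := hX.abs_rho_le_maxCorr hd1 hdn p.2 q.2
  split_ifs with hdI
  · refine le_trans ?_ (le_add_of_nonneg_right he2)
    calc _ ≤ 1 * (K * Real.exp (-v ^ 2 / (1 + σ))) :=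
          mul_le_mul (hcσ.trans hρ.le) (mul_le_mul_of_nonneg_left (hmono hc0 hcσ) hK0)
            (by positivity) zero_le_one
      _ = _ := one_mul _
  · rw [zero_add]
    have hcδ := hX.abs_rho_le_tailMaxCorr hI (not_lt.1 hdI) hdn p.2 q.2
    calc _ ≤ δ * (K * Real.exp (-v ^ 2 / (1 + δ))) :=
          mul_le_mul hcδ (mul_le_mul_of_nonneg_left (hmono hc0 hcδ) hK0) (by positivity) hδ0
      _ = _ := by ring

lemma tendsto_measureReal_rowMax (hX : IsStationaryGaussianArray P X ρ₀ ρ) {α : ℝ}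
    (hA : BermanCondition ρ α) {lam : ℝ≥0∞} (hlam : HuslerReissCondition ρ₀ lam) (x y : ℝ) :
    Tendsto (fun n => P.real {ω | rowMax X n 0 ω ≤ u n x ∧ rowMax X n 1 ω ≤ u n y}) atTop
      (𝓝 (H lam x y)) := by
  have h1 := tendsto_one_sub_tailProb_pow (fun n hn => hX.rho_zero_sq_le_one hn) hlam x y
  set K := 1 / (2 * Real.pi * √(1 - maxCorr ρ ^ 2)) * (Real.pi / 2) with hK
  have hK0 : 0 ≤ K := by positivity
  have hnear := tendsto_mul_rpow_mul_exp (min x y) (maxCorr_nonneg ρ) hA.alpha_lt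
  have hfar := tendsto_sq_mul_mul_exp (min x y)
    (δ := fun n => tailMaxCorr ρ ⌊(n : ℝ) ^ α⌋₊ n) (fun n => tailMaxCorr_nonneg ρ _ n)
    hA.tendsto_zero
  have hbound := ((hnear.const_mul 8).add (hfar.const_mul 4)).mul_const K
  simp only [mul_zero, add_zero, zero_mul] at hbound
  have hdiff : Tendsto (fun n => (1 - tailProb n (ρ₀ n) x y) ^ n -
      P.real {ω | rowMax X n 0 ω ≤ u n x ∧ rowMax X n 1 ω ≤ u n y}) atTop (𝓝 0) := by
    refine squeeze_zero_norm' ?_ hbound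
    filter_upwards [eventually_ge_atTop 2, eventually_u_pos (min x y)] with n hn hu
    have hn1 : (1 : ℝ) ≤ n := by exact_mod_cast (by omega : 1 ≤ n)
    -- The tail maximum must not reach lag `0`, where `ρ` is not a correlation of the array and so
    -- is unconstrained.
    have hI : 1 ≤ ⌊(n : ℝ) ^ α⌋₊ :=
      Nat.le_floor (by simpa using Real.one_le_rpow hn1 hA.alpha_pos.le)
    refine (abs_measureReal_rowMax_sub_le hX hA.maxCorr_lt_one hn hI hu.le).trans ?_
    refine mul_le_mul_of_nonneg_right (add_le_add_left ?_ _) hK0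
    have hfl : (⌊(n : ℝ) ^ α⌋₊ : ℝ) ≤ (n : ℝ) ^ α := Nat.floor_le (by positivity)
    gcongr
  have := h1.sub hdiff
  simpa using this

end Array

end HuslerReiss

end

theorem theorem1p1 {Ω : Type*} [MeasurableSpace Ω] (P : Measure Ω) [IsProbabilityMeasure P]
    (X : (n : ℕ) → Fin n → Fin 2 → Ω → ℝ) (ρ₀ : ℕ → ℝ) (ρ : Fin 2 → Fin 2 → ℕ → ℕ → ℝ)
    (hX : HuslerReiss.IsStationaryGaussianArray P X ρ₀ ρ)
    (α : ℝ) (hA : HuslerReiss.BermanCondition ρ α)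
    (lam : ℝ≥0∞) (hlam : HuslerReiss.HuslerReissCondition ρ₀ lam) :
    Tendsto (fun n : ℕ => ⨆ p : ℝ × ℝ,
        |P.real {ω | HuslerReiss.rowMax X n 0 ω ≤ HuslerReiss.u n p.1 ∧
            HuslerReiss.rowMax X n 1 ω ≤ HuslerReiss.u n p.2} - HuslerReiss.H lam p.1 p.2|)
      atTop (𝓝 0) := by
  have hm (n : ℕ) (i : Fin 2) : AEMeasurable (HuslerReiss.rowMax X n i) P :=
    AEMeasurable.iSup fun k => (hX.hasGaussianLaw n k i).aemeasurable
  refine HuslerReiss.tendsto_iSup_abs_sub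
    (F := fun n p => P.real {ω | HuslerReiss.rowMax X n 0 ω ≤ HuslerReiss.u n p.1 ∧
      HuslerReiss.rowMax X n 1 ω ≤ HuslerReiss.u n p.2})
    (G := fun p => HuslerReiss.H lam p.1 p.2) (fun n p q hpq => ?_)
    (fun n p => measureReal_nonneg) (fun n x y L => ?_) (HuslerReiss.continuous_H lam)
    (fun p => HuslerReiss.tendsto_measureReal_rowMax hX hA hlam p.1 p.2)
    (HuslerReiss.tendsto_H_atTop lam) (HuslerReiss.tendsto_H_neg_atTop lam) ?_
  · exact measureReal_mono fun ω hω => ⟨hω.1.trans (HuslerReiss.u_mono n hpq.1),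
      hω.2.trans (HuslerReiss.u_mono n hpq.2)⟩
  · have hnull : NullMeasurableSet {ω | HuslerReiss.rowMax X n 0 ω ≤ HuslerReiss.u n L ∧
        HuslerReiss.rowMax X n 1 ω ≤ HuslerReiss.u n L} P := by
      rw [Set.ofPred_and]
      exact (nullMeasurableSet_le (hm n 0) aemeasurable_const).inter
        (nullMeasurableSet_le (hm n 1) aemeasurable_const)
    rw [← probReal_compl_eq_one_sub₀ hnull]
    -- Either both maxima lie below `u n L`, and the thresholds may be truncated at `L`, or the
    -- outcome lies in the complement of that event.
    refine (measureReal_mono fun ω hω => ?_).trans (measureReal_union_le _ _)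
    by_cases hL : HuslerReiss.rowMax X n 0 ω ≤ HuslerReiss.u n L ∧
        HuslerReiss.rowMax X n 1 ω ≤ HuslerReiss.u n L
    · left
      refine ⟨?_, ?_⟩
      · rw [(HuslerReiss.u_mono n).map_min]
        exact le_min hω.1 hL.1
      · rw [(HuslerReiss.u_mono n).map_min]
        exact le_min hω.2 hL.2
    · right
      exact hL
  · simp_rw [fun L => HuslerReiss.H_symm lam L (-L)]
    exact HuslerReiss.tendsto_H_neg_atTop lam
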